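/- **Setting.** Let $M=(V,E,F)$ be an oriented, locally finite, simply connected triangulated surface without boundary. For an oriented edge $i\to j$ let $ijk$ and $jil$ be its left and right triangles. The vertices of the dual mesh are the triangles, $V^*=F$, and its faces are the vertices of $M$. A *Delaunay circle pattern* is a map $z:V\to\mathbb C\cup\{\infty\}$ that is injective on the vertices of each triangle and whose cross ratios $X_{ij}=-\frac{(z_k-z_i)(z_l-z_j)}{(z_i-z_l)(z_j-z_k)}$ satisfy $0\le \operatorname{Arg}X_{ij}<\pi$ for all edges and $\sum_j \operatorname{Arg}X_{ij}=2\pi$ at every vertex $i$. The *osculating Möbius transformation* from $z$ to $\tilde z$ is the map $A:V^*\to SL(2,\mathbb C)$ (defined up to a sign on each triangle) such that $A_{ijk}$ sends $z_i,z_j,z_k$ to $\tilde z_i,\tilde z_j,\tilde z_k$. Hyperbolic space $\mathbb H^3$ is the set of Hermitian $2\times2$ matrices with determinant $1$ and positive trace, with the metric induced by $\langle U,V\rangle=-\frac12\operatorname{tr}(U\,\mathrm{adj}\,V)$. Its boundary is $\mathbb C\cup\{\infty\}$, with $z$ corresponding to the ray of $(z,1)^T(\bar z,1)$. It is oriented so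 that the complex orientation of $\mathbb C\cup\{\infty\}$ is the boundary orientation (outward normal first). A *horospherical net* is a map $f:V^*\to\mathbb H^3$ such that the vertices of each dual face $i$ lie on a horosphere, the points of tangency $\tilde z_i$ of these horospheres with $\partial\mathbb H^3$ form a Delaunay circle pattern $\tilde z$ (the *hyperbolic Gauss map*), and each dual edge is realized as the shorter circular arc (of length $\ell\ge 0$) in the intersection circle, of positive radius, of the two neighbouring horospheres. The *dihedral angle* $\alpha\in(-\pi,\pi)$ of a dual edge is given by $\cos\alpha=\langle N_l,N_r\rangle$, $\sin\alpha=\langle N_l\times N_r,T\rangle$, where $T$ is the unit tangent of the oriented arc and $N_l,N_r$ are the unit normals, pointing to the points of tangency, of the horospheres of the dual faces to the left and right. The integrated mean curvature of a dual face $\phi$ is $H_\phi=\operatorname{area}(f(\phi))+\frac12\sum_{e\in\phi}\ell_e\tan\frac{\alpha_e}2$, where $\operatorname{area}$ is the signed area enclosed by the boundary of the face in its horosphere. The net is a *discrete CMC-1 surface* if $H_\phi=\operatorname{area}(f(\phi))$ for every dual face and $0\le \ell\tan\frac\alpha2+\operatorname{Arg}\tilde X<\pi$ for every edge, where $\tilde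 X$ is the cross ratio of $\tilde z$. **Corollary 4.4.** Let $f:V^*\to\mathbb H^3$ be a discrete CMC-1 surface with hyperbolic Gauss map $\tilde z$, edge lengths $\ell$ and dihedral angles $\alpha$. Then there are a Delaunay circle pattern $z$ and an osculating Möbius transformation $A:V^*\to SL(2,\mathbb C)$ from $z$ to $\tilde z$ with $f=AA^*$ such that the following hold. 1. If $\tilde z$ sends no edge of $M$ to a pair of antipodal points of the unit sphere $\mathbb C\cup\{\infty\}$ (points with $\tilde z_i\overline{\tilde z_j}=-1$, or $\{0,\infty\}$), then $\tilde f=A^{-1}(A^{-1})^*$ is a discrete CMC-1 surface with hyperbolic Gauss map $z$, and its edge lengths $\tilde\ell$ and dihedral angles $\tilde\alpha$ satisfy $$\tilde\ell\tan\frac{\tilde\alpha}2=-\ell\tan\frac\alpha2\quad\text{on every edge.}$$ 2. Without any condition on $\tilde z$, there is $B\in SL(2,\mathbb C)$ such that the same holds for $\tilde f=(BA)^{-1}((BA)^{-1})^*$, that is, with $f=AA^*$ replaced by its isometric copy $BfB^*=(BA)(BA)^*$. In particular every discrete CMC-1 surface has a dual discrete CMC-1 surface $\tilde f$ with $\tilde\ell\tan(\tilde\alpha/2)=-\ell\tan(\alpha/2)$.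 -/

import Mathlib

open scoped BigOperators Matrix OnePoint

noncomputable section

namespace DiscreteCMC

/-- 2 by 2 complex matrices. -/
abbrev Mat := Matrix (Fin 2) (Fin 2) ℂ

/-- The special linear group `SL(2, ℂ)`. -/
abbrev SL2 := Matrix.SpecialLinearGroup (Fin 2) ℂ

/-! ### Triangulated surfaces -/

/-- An oriented, locally finite triangulated surface without boundary, given by its oriented edges
(darts). A dart `d` runs from a vertex `i` to a vertex `j` and has on its left the
(counterclockwise) triangle `ijk`; `next d` is then the dart `j → k` of that triangle, and `opp d`
is the reversed dart `j → i`, which has the neighbouring triangle `jil` on its left. The map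
`next ∘ opp` sends `i → j` to `i → l`, the next dart clockwise around `i`; its orbits are the
vertices, the orbits of `next` are the triangles. -/
structure TriSurface where
  Dart : Type*
  next : Equiv.Perm Dart
  opp : Equiv.Perm Dart
  next_next_next : ∀ d, next (next (next d)) = d
  next_ne : ∀ d, next d ≠ d
  opp_opp : ∀ d, opp (opp d) = d
  opp_ne : ∀ d, opp d ≠ d
  finite_degree : ∀ d, {e | (next * opp).SameCycle d e}.Finite

namespace TriSurface

variable (M : TriSurface)

/-- Clockwise rotation around the source of a dart. -/
def rot : Equiv.Perm M.Dart := M.next * M.opp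

/-- Vertices of the triangulation; equivalently, faces of the dual mesh. -/
def Vertex := Quotient (Equiv.Perm.SameCycle.setoid M.rot)

/-- Triangles of the triangulation; equivalently, vertices of the dual mesh. -/
def Face := Quotient (Equiv.Perm.SameCycle.setoid M.next)

variable {M}

/-- The source vertex of a dart. -/
def src (d : M.Dart) : M.Vertex := Quotient.mk (Equiv.Perm.SameCycle.setoid M.rot) d

/-- The target vertex of a dart. -/
def tgt (d : M.Dart) : M.Vertex := src (M.opp d)

/-- The triangle to the left of a dart. -/
def left (d : M.Dart) : M.Face := Quotient.mk (Equiv.Perm.SameCycle.setoid M.next) d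

/-- The triangle to the right of a dart. -/
def right (d : M.Dart) : M.Face := left (M.opp d)

/-- The third vertex `k` of the triangle `ijk` to the left of the dart `i → j`. -/
def apex (d : M.Dart) : M.Vertex := src (M.next (M.next d))

theorem finite_star (v : M.Vertex) : {d : M.Dart | src d = v}.Finite := by
  induction v using Quotient.inductionOn with
  | h e =>
    refine (M.finite_degree e).subset fun d hd => ?_
    exact (Quotient.exact hd : M.rot.SameCycle d e).symm

/-- The darts that start at the vertex `v`. -/
def star (v : M.Vertex) : Finset M.Dart := (finite_star v).toFinset

/-- `p` is an edge path of the dual mesh from `u` to `v`: every dart in the list is crossed from its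
left triangle to its right triangle. -/
def IsDualPath : M.Face → List M.Dart → M.Face → Prop
  | u, [], v => u = v
  | u, d :: p, v => left d = u ∧ IsDualPath (right d) p v

/-- The dual edge loop that goes once around the source of `d`, beginning with the crossing
of `d`. -/
def vertexLoop (d : M.Dart) : List M.Dart :=
  (List.range (Function.minimalPeriod M.rot d)).map fun k => (M.rot ^ k) d

/-- Elementary homotopies of dual edge paths: insert a backtracking, or insert the boundary of a dual
face. -/
def Step (p q : List M.Dart) : Prop :=
  ∃ (a b : List M.Dart) (d : M.Dart),
    p = a ++ b ∧ (q = a ++ [d, M.opp d] ++ b ∨ q = a ++ vertexLoop d ++ b)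

variable (M)

/-- The surface is simply connected: it is connected, and every closed edge path of the dual mesh is
homotopic to the constant path. -/
def SimplyConnected : Prop :=
  (∀ u v : M.Face, ∃ p, IsDualPath u p v) ∧
    ∀ (u : M.Face) (p : List M.Dart), IsDualPath u p u →
      Relation.EqvGen (fun q r => IsDualPath u q u ∧ IsDualPath u r u ∧ Step q r) p []

end TriSurface

/-! ### Circle patterns -/

/-- Homogeneous coordinates of a point of the Riemann sphere `ℂ ∪ {∞}`. -/
def homog (z : OnePoint ℂ) : Fin 2 → ℂ := z.elim ![1, 0] fun w => ![w, 1]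

/-- `det ((z, 1)ᵀ, (w, 1)ᵀ)`, which is `z - w` for finite points. -/
def bracket (z w : OnePoint ℂ) : ℂ :=
  homog z 0 * homog w 1 - homog w 0 * homog z 1

/-- The Möbius transformation given by `A` sends `z` to `w`. -/
def Maps (A : SL2) (z w : OnePoint ℂ) : Prop :=
  ∃ c : ℂ, c ≠ 0 ∧ (A : Mat) *ᵥ homog z = c • homog w

/-- `z` and `w` are antipodal points of the unit sphere `ℂ ∪ {∞}`, that is, `z * conj w = -1` or
`{z, w} = {0, ∞}`. -/
def Antipodal (z w : OnePoint ℂ) : Prop :=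
  homog z ⬝ᵥ (fun k => starRingEnd ℂ (homog w k)) = 0

section CirclePattern

variable {M : TriSurface}

/-- The cross ratio `X_ij = -((z_k - z_i) (z_l - z_j)) / ((z_i - z_l) (z_j - z_k))` of the edge of a
dart `i → j` with left triangle `ijk` and right triangle `jil`, in homogeneous coordinates. -/
def crossRatio (z : M.Vertex → OnePoint ℂ) (d : M.Dart) : ℂ :=
  let i := z (TriSurface.src d)
  let j := z (TriSurface.tgt d)
  let k := z (TriSurface.apex d)
  let l := z (TriSurface.apex (M.opp d))
  (-1) * (bracket k i * bracket l j) / (bracket i l * bracket j k)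

/-- `z` is an (unbranched) Delaunay circle pattern. -/
structure IsDelaunay (z : M.Vertex → OnePoint ℂ) : Prop where
  ne : ∀ d : M.Dart, z (TriSurface.src d) ≠ z (TriSurface.tgt d)
  arg_nonneg : ∀ d : M.Dart, 0 ≤ (crossRatio z d).arg
  arg_lt : ∀ d : M.Dart, (crossRatio z d).arg < Real.pi
  sum_arg : ∀ v : M.Vertex,
    ∑ d ∈ TriSurface.star v, (crossRatio z d).arg = 2 * Real.pi

/-- `A` is (a lift to `SL(2, ℂ)` of) the osculating Möbius transformation from `z` to `w`: for
every triangle, `A` maps the three vertices under `z` to the three vertices under `w`. -/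
def IsOsculating (z w : M.Vertex → OnePoint ℂ) (A : M.Face → SL2) : Prop :=
  ∀ d : M.Dart, Maps (A (TriSurface.left d)) (z (TriSurface.src d)) (w (TriSurface.src d))

end CirclePattern

/-! ### Hyperbolic space in the Hermitian matrix model -/

/-- The Minkowski product `⟨U, V⟩ = -½ tr (U Ṽ)` with `Ṽ` the cofactor matrix. -/
def mink (U V : Mat) : ℝ := -(1 / 2) * (U * V.adjugate).trace.re

/-- Hyperbolic 3-space: Hermitian matrices of determinant `1` and positive trace. -/
def hyperbolicSpace : Set Mat := {x | x.IsHermitian ∧ x.det = 1 ∧ 0 < x.trace.re}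

/-- `U` is a vector of the upper light cone on the ray of the boundary point `z`. -/
def LightVector (U : Mat) (z : OnePoint ℂ) : Prop :=
  ∃ r : ℝ, 0 < r ∧
    U = (r : ℂ) • Matrix.vecMulVec (homog z) (fun k => starRingEnd ℂ (homog z k))

/-- The horosphere of a vector `U` of the upper light cone. If `U` lies on the ray of `z`, this
horosphere touches the boundary of hyperbolic space at `z`. -/
def horosphere (U : Mat) : Set Mat := {x | x ∈ hyperbolicSpace ∧ mink x U = -1}

/-- The unit normal at `x` of the horosphere of `U` that points to its point of tangency with the
boundary: it has Minkowski norm `1`, is orthogonal to `x` and to the tangent space of the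
horosphere, and `cosh t • x + sinh t • normal U x` tends to the ray of `U`. -/
def normal (U x : Mat) : Mat := U - x

/-- The coordinates `(x₀, x₁, x₂, x₃)` of a Hermitian matrix
`!![x₀ + x₃, x₁ + i x₂; x₁ - i x₂, x₀ - x₃]`. -/
def coords (U : Mat) : Fin 4 → ℝ :=
  ![((U 0 0).re + (U 1 1).re) / 2, (U 0 1).re, (U 0 1).im, ((U 0 0).re - (U 1 1).re) / 2]

/-- The triple product `⟨a × b, c⟩` of tangent vectors at `x` of hyperbolic space. Hyperbolic space
is oriented so that its boundary `ℂ ∪ {∞}` carries the complex orientation as the boundary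
orientation (outward normal first). -/
def triple (x a b c : Mat) : ℝ :=
  -(Matrix.of ![coords x, coords a, coords b, coords c]).det

/-- A parametrised circular arc `s ↦ center + cos s • p + sin s • q`, `0 ≤ s ≤ angle`, in the
space of Hermitian matrices, where `p` and `q` are orthogonal spacelike vectors of the same
length. It is at most half of its circle. -/
structure CircArc where
  center : Mat
  p : Mat
  q : Mat
  angle : ℝ
  p_herm : p.IsHermitian
  q_herm : q.IsHermitian
  pp_pos : 0 < mink p p
  qq_eq : mink q q = mink p p
  pq_eq : mink p q = 0
  angle_nonneg : 0 ≤ angle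
  angle_le : angle ≤ Real.pi

namespace CircArc

variable (γ : CircArc)

/-- The point of the circle at parameter `s`. -/
def pos (s : ℝ) : Mat := γ.center + (Real.cos s : ℂ) • γ.p + (Real.sin s : ℂ) • γ.q

/-- The velocity of `pos` at parameter `s`. -/
def vel (s : ℝ) : Mat := (-(Real.sin s) : ℂ) • γ.p + (Real.cos s : ℂ) • γ.q

/-- The speed with respect to the induced metric. -/
def speed (s : ℝ) : ℝ := Real.sqrt (mink (γ.vel s) (γ.vel s))

/-- The unit tangent vector. -/
def tangent (s : ℝ) : Mat := ((γ.speed s)⁻¹ : ℂ) • γ.vel s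

/-- The hyperbolic length of the arc. -/
def length : ℝ := ∫ s in (0 : ℝ)..γ.angle, γ.speed s

end CircArc

/-! ### Horospherical nets and discrete CMC-1 surfaces -/

/-- A horospherical net on the dual mesh of `M`. The dual edge of a dart `d` is oriented from the
triangle left of `d` to the triangle right of `d`; the dual face on its left is `tgt d` and the one
on its right is `src d`. -/
structure HorosphericalNet (M : TriSurface) where
  /-- the realization `V* → ℍ³` -/
  point : M.Face → Mat
  point_mem : ∀ u, point u ∈ hyperbolicSpace
  /-- the hyperbolic Gauss map, which is a Delaunay circle pattern -/
  gauss : M.Vertex → OnePoint ℂ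
  gauss_delaunay : IsDelaunay gauss
  /-- the horospheres of the dual faces -/
  horo : M.Vertex → Mat
  horo_gauss : ∀ v, LightVector (horo v) (gauss v)
  point_mem_horo : ∀ d : M.Dart,
    point (TriSurface.left d) ∈ horosphere (horo (TriSurface.src d))
  /-- the dual edges: shorter circular arcs in the intersection of the neighbouring horospheres -/
  arc : M.Dart → CircArc
  arc_mem : ∀ d s, (arc d).pos s ∈
    horosphere (horo (TriSurface.src d)) ∩ horosphere (horo (TriSurface.tgt d))
  arc_start : ∀ d, (arc d).pos 0 = point (TriSurface.left d)
  arc_end : ∀ d, (arc d).pos (arc d).angle = point (TriSurface.right d)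
  arc_opp_angle : ∀ d, (arc (M.opp d)).angle = (arc d).angle
  arc_opp : ∀ d s, (arc (M.opp d)).pos s = (arc d).pos ((arc d).angle - s)
  /-- the dihedral angle between the neighbouring horospheres -/
  dihedral : M.Dart → ℝ
  dihedral_mem : ∀ d, dihedral d ∈ Set.Ioo (-Real.pi) Real.pi
  cos_dihedral : ∀ d, ∀ s ∈ Set.Icc 0 (arc d).angle,
    Real.cos (dihedral d) =
      mink (normal (horo (TriSurface.tgt d)) ((arc d).pos s))
        (normal (horo (TriSurface.src d)) ((arc d).pos s))
  sin_dihedral : ∀ d, ∀ s ∈ Set.Icc 0 (arc d).angle,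
    Real.sin (dihedral d) =
      triple ((arc d).pos s) (normal (horo (TriSurface.tgt d)) ((arc d).pos s))
        (normal (horo (TriSurface.src d)) ((arc d).pos s)) ((arc d).tangent s)

namespace HorosphericalNet

variable {M : TriSurface} (S : HorosphericalNet M)

/-- The hyperbolic length of the dual edge. -/
def length (d : M.Dart) : ℝ := (S.arc d).length

/-- The edge quantity `ℓ tan (α / 2)`. -/
def edgeTerm (d : M.Dart) : ℝ := S.length d * Real.tan (S.dihedral d / 2)

/-- The (signed) area enclosed by the realization of the dual face of `v` in its horosphere, which
is a Euclidean plane: the line integral `½ ∮ w₁ dw₂ - w₂ dw₁` along the boundary of the face. Here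
`o` is a vertex of the face, every point of the horosphere of `U` is uniquely of the form
`o + w + ½ ⟨w, w⟩ U` with `w` orthogonal to `o` and `U`, and `w` is a Euclidean coordinate. -/
def area (v : M.Vertex) : ℝ :=
  let o := S.point (TriSurface.left (Quotient.out v))
  1 / 2 * ∑ d ∈ TriSurface.star v, ∫ s in (0 : ℝ)..(S.arc d).angle,
    triple o (S.horo v) ((S.arc d).pos s) ((S.arc d).vel s)

/-- The integrated mean curvature of the dual face of `v`. -/
def meanCurvature (v : M.Vertex) : ℝ :=
  S.area v + 1 / 2 * ∑ d ∈ TriSurface.star v, S.edgeTerm d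

/-- Discrete surfaces of constant mean curvature 1: the integrated mean curvature of every face is
`1` times its area, and `0 ≤ ℓ tan (α / 2) + Arg X < π` for the cross ratio `X` of the Gauss
map. -/
structure IsCMC1 : Prop where
  mean_curvature : ∀ v : M.Vertex, S.meanCurvature v = 1 * S.area v
  edge_nonneg : ∀ d : M.Dart, 0 ≤ S.edgeTerm d + (crossRatio S.gauss d).arg
  edge_lt : ∀ d : M.Dart, S.edgeTerm d + (crossRatio S.gauss d).arg < Real.pi

end HorosphericalNet

end DiscreteCMC

end

noncomputable section

namespace DiscreteCMC

open Matrix ComplexConjugate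

/-! Take as frame of an edge the matrix whose columns are homogeneous coordinates of its two end
points under the Gauss map. In this frame the light vectors of the two horospheres are diagonal, so
a common point has prescribed diagonal entries, and the determinant fixes the modulus of its
off-diagonal entry. The intersection circle is therefore an orbit of the rotations about the
geodesic joining the points of tangency (`exists_edgeForm`). If it has radius ρ and the arc turns
through the signed angle θ = ηφ with η = ±1, then ℓ = ρφ and tan(α/2) = -η/ρ, so ℓ tan(α/2) = -θ
(`exists_edge`).

The rotation R of an edge has eigenvalues exp(±iθ/2) on the two end points, and the mean curvature
condition says that θ sums to zero around each vertex. The product of the R around a vertex then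
fixes a homogeneous vector and a point of hyperbolic space, hence is trivial (`eq_one_of_fixes`). By
simple connectivity the R integrate to A with A_right = R A_left and f = AA* (`exists_transport`).
Across an edge A⁻¹ changes only by phases on the two end point vectors. So it carries the Gauss map
to a well-defined z, and cross ratios are multiplied by exp(-iθ) (`crossRatio_eq_mul_phase`). The
CMC inequalities keep their arguments in [0, π), and the zero sums preserve the angle sum 2π.

Conversely, neighbouring points A⁻¹(A⁻¹)* differ by a rotation through -θ about the geodesic of z,
which gives a net with edge terms θ (`exists_net`). The only obstruction is a circle of radius zero,
which occurs when the end points under the original Gauss map are antipodal. An edge becomes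
antipodal for only finitely many real translations, and there are countably many edges, so some
translation B avoids them all. -/

/-! ### Hermitian matrices and the action of 2 by 2 matrices. -/

/-- The Hermitian matrix with diagonal `a`, `b` and upper right entry `β`. -/
def herm (a b : ℝ) (β : ℂ) : Mat := !![(a : ℂ), β; conj β, (b : ℂ)]

/-- The action `Y ↦ T Y T*` on Hermitian matrices. -/
def sand (T Y : Mat) : Mat := T * Y * Tᴴ

theorem sand_add (T X Y : Mat) : sand T (X + Y) = sand T X + sand T Y := by
  simp [sand, Matrix.mul_add, Matrix.add_mul]

theorem sand_smul (T Y : Mat) (c : ℂ) : sand T (c • Y) = c • sand T Y := by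
  simp [sand]

theorem sand_sand (S T Y : Mat) : sand S (sand T Y) = sand (S * T) Y := by
  simp [sand, Matrix.conjTranspose_mul, Matrix.mul_assoc]

theorem isHermitian_herm (a b : ℝ) (β : ℂ) : (herm a b β).IsHermitian := by
  ext i j
  fin_cases i <;> fin_cases j <;> simp [herm]

theorem isHermitian_sand {Y : Mat} (T : Mat) (hY : Y.IsHermitian) : (sand T Y).IsHermitian :=
  Matrix.isHermitian_mul_mul_conjTranspose T hY

theorem eq_herm_of_isHermitian {Y : Mat} (hY : Y.IsHermitian) :
    Y = herm (Y 0 0).re (Y 1 1).re (Y 0 1) := by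
  have h := fun i j => congrFun (congrFun hY i) j
  simp only [Matrix.conjTranspose_apply] at h
  have h0 := Complex.conj_eq_iff_re.1 (h 0 0)
  have h1 := Complex.conj_eq_iff_re.1 (h 1 1)
  ext i j
  fin_cases i <;> fin_cases j <;> simp [herm, h0, h1]
  exact (h 1 0).symm

theorem exists_sand_herm {T X : Mat} (hT : T.det ≠ 0) (hX : X.IsHermitian) :
    ∃ (a b : ℝ) (β : ℂ), X = sand T (herm a b β) := by
  have hu : IsUnit T.det := isUnit_iff_ne_zero.2 hT
  have h : X = sand T (sand T⁻¹ X) := by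
    rw [sand_sand, Matrix.mul_nonsing_inv _ hu]
    simp [sand]
  rw [eq_herm_of_isHermitian (isHermitian_sand T⁻¹ hX)] at h
  exact ⟨_, _, _, h⟩

theorem herm_add (a b a' b' : ℝ) (β β' : ℂ) :
    herm a b β + herm a' b' β' = herm (a + a') (b + b') (β + β') := by
  ext i j
  fin_cases i <;> fin_cases j <;> simp [herm]

theorem real_smul_herm (r a b : ℝ) (β : ℂ) :
    (r : ℂ) • herm a b β = herm (r * a) (r * b) (r * β) := by
  ext i j
  fin_cases i <;> fin_cases j <;> simp [herm]

theorem det_herm (a b : ℝ) (β : ℂ) :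
    (herm a b β).det = ((a * b - Complex.normSq β : ℝ) : ℂ) := by
  simp [herm, Matrix.det_fin_two, Complex.mul_conj]

theorem det_sand (T Y : Mat) : (sand T Y).det = (Complex.normSq T.det : ℂ) * Y.det := by
  simp only [sand, Matrix.det_mul, Matrix.det_conjTranspose, ← Complex.mul_conj, starRingEnd_apply]
  ring

theorem adjugate_sand (T Y : Mat) :
    (sand T Y).adjugate = Tᴴ.adjugate * Y.adjugate * T.adjugate := by
  simp [sand, Matrix.adjugate_mul_distrib, Matrix.mul_assoc]

/-- The inner factor T* adj(T*) is scalar, so X adj Y is merely conjugated by T up to scalars. Both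
`mink` and `triple` are traces of such products, which yields their invariance. -/
theorem sand_mul_adjugate_sand (T X Y : Mat) :
    sand T X * (sand T Y).adjugate = conj T.det • (T * (X * Y.adjugate) * T.adjugate) := by
  have h : Tᴴ * Tᴴ.adjugate = conj T.det • (1 : Mat) := by
    rw [Matrix.mul_adjugate, Matrix.det_conjTranspose, starRingEnd_apply]
  rw [adjugate_sand, sand]
  calc T * X * Tᴴ * (Tᴴ.adjugate * Y.adjugate * T.adjugate)
      = T * X * (Tᴴ * Tᴴ.adjugate) * Y.adjugate * T.adjugate := by simp only [Matrix.mul_assoc]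
    _ = _ := by rw [h]; simp [Matrix.mul_assoc]

theorem trace_conj_adjugate (T X : Mat) : (T * X * T.adjugate).trace = T.det * X.trace := by
  rw [Matrix.trace_mul_comm, ← Matrix.mul_assoc, Matrix.adjugate_mul]
  simp

theorem mink_sand (T X Y : Mat) :
    mink (sand T X) (sand T Y) = Complex.normSq T.det * mink X Y := by
  rw [mink, mink, sand_mul_adjugate_sand, Matrix.trace_smul, trace_conj_adjugate, smul_eq_mul,
    ← mul_assoc, mul_comm (conj _), Complex.mul_conj, Complex.re_ofReal_mul]
  ring

theorem mink_herm (a b a' b' : ℝ) (β β' : ℂ) :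
    mink (herm a b β) (herm a' b' β') =
      -(1 / 2) * (a * b' + a' * b) + (β.re * β'.re + β.im * β'.im) := by
  simp [mink, herm, Matrix.adjugate_fin_two, Matrix.trace_fin_two]
  ring

/-- The determinant in coordinates is not visibly invariant under `sand`; the trace form is. -/
theorem triple_eq_trace {x a b c : Mat} (hx : x.IsHermitian) (ha : a.IsHermitian)
    (hb : b.IsHermitian) (hc : c.IsHermitian) :
    triple x a b c = 1 / 2 * (x * a.adjugate * (b * c.adjugate)).trace.im := by
  rw [eq_herm_of_isHermitian hx, eq_herm_of_isHermitian ha, eq_herm_of_isHermitian hb,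
    eq_herm_of_isHermitian hc]
  generalize (x 0 0).re = x0, (x 1 1).re = x1, x 0 1 = x2
  generalize (a 0 0).re = a0, (a 1 1).re = a1, a 0 1 = a2
  generalize (b 0 0).re = b0, (b 1 1).re = b1, b 0 1 = b2
  generalize (c 0 0).re = c0, (c 1 1).re = c1, c 0 1 = c2
  simp [triple, coords, herm, Matrix.adjugate_fin_two, Matrix.trace_fin_two,
    Matrix.det_succ_row_zero, Fin.sum_univ_succ, Fin.succAbove]
  ring

theorem triple_sand {x a b c : Mat} (T : Mat) (hx : x.IsHermitian) (ha : a.IsHermitian)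
    (hb : b.IsHermitian) (hc : c.IsHermitian) :
    triple (sand T x) (sand T a) (sand T b) (sand T c) =
      Complex.normSq T.det ^ 2 * triple x a b c := by
  have h (X Y : Mat) : T * X * T.adjugate * (T * Y * T.adjugate) =
      T.det • (T * (X * Y) * T.adjugate) := by
    calc T * X * T.adjugate * (T * Y * T.adjugate)
        = T * X * (T.adjugate * T) * Y * T.adjugate := by simp only [Matrix.mul_assoc]
      _ = _ := by rw [Matrix.adjugate_mul]; simp [Matrix.mul_assoc]
  rw [triple_eq_trace (isHermitian_sand T hx) (isHermitian_sand T ha) (isHermitian_sand T hb)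
    (isHermitian_sand T hc), triple_eq_trace hx ha hb hc, sand_mul_adjugate_sand,
    sand_mul_adjugate_sand, Matrix.smul_mul, Matrix.mul_smul, h, Matrix.trace_smul,
    Matrix.trace_smul, Matrix.trace_smul, trace_conj_adjugate]
  simp only [smul_eq_mul]
  have : conj T.det * (conj T.det * (T.det * (T.det * (x * a.adjugate * (b * c.adjugate)).trace)))
      = ((Complex.normSq T.det ^ 2 : ℝ) : ℂ) * (x * a.adjugate * (b * c.adjugate)).trace := by
    push_cast
    rw [← Complex.mul_conj]
    ring
  rw [this, Complex.im_ofReal_mul]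
  ring

theorem triple_herm_diag (a b : ℝ) (β ζ : ℂ) (ri rj : ℝ) :
    triple (herm a b β) (herm 0 rj 0 - herm a b β) (herm ri 0 0 - herm a b β) (herm 0 0 ζ) =
      -(ri * rj / 2 * (β.re * ζ.im - β.im * ζ.re)) := by
  simp [triple, coords, herm, Matrix.det_succ_row_zero, Fin.sum_univ_succ, Fin.succAbove]
  ring

/-! ### Circles around the geodesic of a frame. -/

/-- The unit complex number with argument `t`. -/
def phase (t : ℝ) : ℂ := Complex.exp (t * Complex.I)

theorem phase_add (s t : ℝ) : phase (s + t) = phase s * phase t := by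
  simp [phase, ← Complex.exp_add, add_mul]

theorem phase_zero : phase 0 = 1 := by simp [phase]

theorem phase_ne_zero (t : ℝ) : phase t ≠ 0 := Complex.exp_ne_zero _

theorem conj_phase (t : ℝ) : conj (phase t) = phase (-t) := by
  rw [phase, phase, ← Complex.exp_conj]
  simp

theorem phase_mul_neg (t : ℝ) : phase t * phase (-t) = 1 := by
  rw [← phase_add, add_neg_cancel, phase_zero]

theorem phase_eq (t : ℝ) : phase t = Real.cos t + Real.sin t * Complex.I := by
  simp [phase, Complex.exp_mul_I]

theorem normSq_phase (t : ℝ) : Complex.normSq (phase t) = 1 := by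
  rw [Complex.normSq_eq_norm_sq, phase, Complex.norm_exp_ofReal_mul_I, one_pow]

theorem phase_sign_mul {η : ℝ} (hη : η = 1 ∨ η = -1) (s : ℝ) :
    phase (η * s) = Real.cos s + Real.sin s * (η * Complex.I) := by
  rcases hη with rfl | rfl <;> simp [phase_eq, mul_comm]

/-- The arc `γ` is part of the circle of the points `sand T (herm a b (β * phase (η * s)))`. -/
structure EdgeForm (γ : CircArc) (T : Mat) (a b : ℝ) (β : ℂ) (η : ℝ) : Prop where
  center_eq : γ.center = sand T (herm a b 0)
  p_eq : γ.p = sand T (herm 0 0 β)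
  q_eq : γ.q = sand T (herm 0 0 (β * (η * Complex.I)))
  det_ne : T.det ≠ 0
  ne_zero : β ≠ 0
  sign : η = 1 ∨ η = -1

theorem sign_sq {η : ℝ} (h : η = 1 ∨ η = -1) : η ^ 2 = 1 := by
  rcases h with rfl | rfl <;> norm_num

/-- The determinant condition gives ρ² + 1 = |det T|² a b, and the product of the two horosphere
equations eliminates a and b. The weights thus enter angles only through the radius ρ. -/
theorem weight_eq {T : Mat} {a b : ℝ} {β : ℂ} {ri rj : ℝ}
    (hi : ri * Complex.normSq T.det * b = 2) (hj : rj * Complex.normSq T.det * a = 2)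
    (hd : Complex.normSq T.det * (a * b - Complex.normSq β) = 1) {ρ : ℝ}
    (hρ : ρ ^ 2 = Complex.normSq T.det * Complex.normSq β) :
    ri * rj * Complex.normSq T.det * (ρ ^ 2 + 1) = 4 := by
  have h2 : ρ ^ 2 + 1 = Complex.normSq T.det * (a * b) := by linear_combination hρ - hd
  rw [h2]
  linear_combination (rj * Complex.normSq T.det * a) * hi + 2 * hj

namespace EdgeForm

variable {γ : CircArc} {T : Mat} {a b : ℝ} {β : ℂ} {η : ℝ} (h : EdgeForm γ T a b β η)

include h

theorem pos_eq (s : ℝ) : γ.pos s = sand T (herm a b (β * phase (η * s))) := by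
  rw [CircArc.pos, h.center_eq, h.p_eq, h.q_eq, ← sand_smul, ← sand_smul, ← sand_add, ← sand_add,
    real_smul_herm, real_smul_herm, herm_add, herm_add,
    phase_sign_mul h.sign]
  congr 2 <;> ring

theorem vel_eq (s : ℝ) :
    γ.vel s = sand T (herm 0 0 (β * phase (η * s) * (η * Complex.I))) := by
  have hs : (η : ℂ) ^ 2 = 1 := by exact_mod_cast sign_sq h.sign
  rw [CircArc.vel, h.p_eq, h.q_eq, ← sand_smul, ← sand_smul, ← sand_add,
    ← Complex.ofReal_neg, real_smul_herm,
    real_smul_herm, herm_add, phase_sign_mul h.sign]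
  congr 2
  · ring
  · ring
  · push_cast
    linear_combination (Complex.sin s : ℂ) * β * hs - β * Complex.sin s * η ^ 2 * Complex.I_sq

theorem normSq_pos : 0 < Complex.normSq T.det * Complex.normSq β :=
  mul_pos (Complex.normSq_pos.2 h.det_ne) (Complex.normSq_pos.2 h.ne_zero)

theorem speed_eq (s : ℝ) : γ.speed s = √(Complex.normSq T.det * Complex.normSq β) := by
  rw [CircArc.speed, h.vel_eq, mink_sand, mink_herm]
  congr 2
  have : Complex.normSq (β * phase (η * s) * (η * Complex.I)) = Complex.normSq β := by
    simp only [Complex.normSq_mul, normSq_phase, Complex.normSq_I, Complex.normSq_ofReal]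
    linear_combination Complex.normSq β * sign_sq h.sign
  rw [← this, Complex.normSq_apply]
  ring

theorem length_eq : γ.length = γ.angle * √(Complex.normSq T.det * Complex.normSq β) := by
  rw [CircArc.length]
  simp [h.speed_eq]

theorem tangent_eq (s : ℝ) : γ.tangent s =
    sand T (herm 0 0 (((√(Complex.normSq T.det * Complex.normSq β))⁻¹ : ℝ) *
      (β * phase (η * s) * (η * Complex.I)))) := by
  rw [CircArc.tangent, h.speed_eq, h.vel_eq, ← Complex.ofReal_inv, ← sand_smul, real_smul_herm]
  simp

theorem mink_pos_left (s r : ℝ) : mink (γ.pos s) (sand T (herm r 0 0)) =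
    -(1 / 2) * (r * Complex.normSq T.det * b) := by
  rw [h.pos_eq, mink_sand, mink_herm]
  simp
  ring

theorem mink_pos_right (s r : ℝ) : mink (γ.pos s) (sand T (herm 0 r 0)) =
    -(1 / 2) * (r * Complex.normSq T.det * a) := by
  rw [h.pos_eq, mink_sand, mink_herm]
  simp
  ring

variable {ri rj : ℝ} (hi : ri * Complex.normSq T.det * b = 2)
  (hj : rj * Complex.normSq T.det * a = 2)
  (hd : Complex.normSq T.det * (a * b - Complex.normSq β) = 1)

include hi hj hd

/-- Rotations about the geodesic preserve both horospheres, so the parameter `s` enters only through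
the modulus of β. -/
theorem mink_normal (s : ℝ) {ρ : ℝ} (hρ : ρ ^ 2 = Complex.normSq T.det * Complex.normSq β) :
    mink (normal (sand T (herm 0 rj 0)) (γ.pos s)) (normal (sand T (herm ri 0 0)) (γ.pos s)) =
      (ρ ^ 2 - 1) / (ρ ^ 2 + 1) := by
  have h0 : ρ ^ 2 + 1 ≠ 0 := by positivity
  have hw := weight_eq hi hj hd hρ
  have e (U V : Mat) : sand T U - sand T V = sand T (U + ((-1 : ℝ) : ℂ) • V) := by
    rw [sand_add, sand_smul, sub_eq_add_neg]
    simp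
  rw [normal, normal, h.pos_eq, e, e, mink_sand, real_smul_herm, herm_add, herm_add, mink_herm,
    eq_div_iff h0]
  have hn : Complex.normSq (β * phase (η * s)) = Complex.normSq β := by
    rw [Complex.normSq_mul, normSq_phase, mul_one]
  rw [Complex.normSq_apply] at hn
  simp only [Complex.ofReal_neg, Complex.ofReal_one, neg_mul, one_mul, zero_add, Complex.neg_re,
    Complex.neg_im]
  linear_combination (Complex.normSq T.det * (ρ ^ 2 + 1)) * hn - 1 / 2 * hw
    + 1 / 2 * (ρ ^ 2 + 1) * hi + 1 / 2 * (ρ ^ 2 + 1) * hj - (ρ ^ 2 + 1) * hd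

theorem triple_normal (s : ℝ) {ρ : ℝ} (hρ0 : 0 < ρ)
    (hρ : ρ ^ 2 = Complex.normSq T.det * Complex.normSq β) :
    triple (γ.pos s) (normal (sand T (herm 0 rj 0)) (γ.pos s))
      (normal (sand T (herm ri 0 0)) (γ.pos s)) (γ.tangent s) = -η * (2 * ρ / (ρ ^ 2 + 1)) := by
  have h0 : ρ ^ 2 + 1 ≠ 0 := by positivity
  have hw := weight_eq hi hj hd hρ
  have hs : √(Complex.normSq T.det * Complex.normSq β) = ρ := by
    rw [← hρ, Real.sqrt_sq hρ0.le]
  have e (U V : Mat) : sand T U - sand T V = sand T (U - V) := by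
    simp [sand, Matrix.mul_sub, Matrix.sub_mul]
  rw [normal, normal, h.tangent_eq, h.pos_eq, e, e, hs, triple_sand T (isHermitian_herm _ _ _)
    ((isHermitian_herm _ _ _).sub (isHermitian_herm _ _ _))
    ((isHermitian_herm _ _ _).sub (isHermitian_herm _ _ _)) (isHermitian_herm _ _ _),
    triple_herm_diag]
  have hn : Complex.normSq (β * phase (η * s)) = Complex.normSq β := by
    rw [Complex.normSq_mul, normSq_phase, mul_one]
  generalize β * phase (η * s) = ζ at hn
  have e2 : ζ.re * (((ρ⁻¹ : ℝ) : ℂ) * (ζ * (η * Complex.I))).im -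
      ζ.im * (((ρ⁻¹ : ℝ) : ℂ) * (ζ * (η * Complex.I))).re = ρ⁻¹ * η * Complex.normSq β := by
    rw [← hn, Complex.normSq_apply]
    simp only [Complex.mul_re, Complex.mul_im,
      Complex.ofReal_re, Complex.ofReal_im, Complex.I_re, Complex.I_im]
    ring
  rw [e2]
  field_simp
  linear_combination -(Complex.normSq T.det * η * Complex.normSq β) * hw + 4 * η * hρ

end EdgeForm

/-! ### Half-angle formulas for the dihedral angle. -/

/-- Half of the dihedral angle from its cosine and sine. -/
theorem tan_half_of_cos_sin {α ρ η : ℝ} (hρ : 0 < ρ)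
    (hc : Real.cos α = (ρ ^ 2 - 1) / (ρ ^ 2 + 1)) (hs : Real.sin α = -η * (2 * ρ / (ρ ^ 2 + 1))) :
    ρ * Real.tan (α / 2) = -η := by
  have h0 : ρ ^ 2 + 1 ≠ 0 := by positivity
  have h2 : α = 2 * (α / 2) := by ring
  rw [h2, Real.cos_two_mul] at hc
  rw [h2, Real.sin_two_mul] at hs
  have hc2 : Real.cos (α / 2) ^ 2 = ρ ^ 2 / (ρ ^ 2 + 1) := by
    have : (ρ ^ 2 - 1) / (ρ ^ 2 + 1) = 2 * (ρ ^ 2 / (ρ ^ 2 + 1)) - 1 := by field_simp; ring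
    linarith
  have hc0 : Real.cos (α / 2) ≠ 0 := by
    intro h
    rw [h] at hc2
    have : ρ ^ 2 / (ρ ^ 2 + 1) > 0 := by positivity
    norm_num at hc2
    linarith
  rw [Real.tan_eq_sin_div_cos, mul_div_assoc', div_eq_iff hc0]
  apply mul_right_cancel₀ hc0
  have e : ρ * Real.sin (α / 2) * Real.cos (α / 2) = -η * (ρ ^ 2 / (ρ ^ 2 + 1)) := by
    linear_combination ρ / 2 * hs
  rw [e, ← hc2]
  ring

/-- With its sine counterpart, the converse of `tan_half_of_cos_sin`: it allows the dihedral angle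
of the dual net to be defined by an arctangent. -/
theorem cos_two_arctan_inv {ρ η : ℝ} (hρ : 0 < ρ) (hη : η = 1 ∨ η = -1) :
    Real.cos (2 * Real.arctan (-η / ρ)) = (ρ ^ 2 - 1) / (ρ ^ 2 + 1) := by
  rw [Real.cos_two_mul, Real.cos_sq_arctan, div_pow, neg_sq, sign_sq hη]
  field_simp
  ring

theorem sin_two_arctan_inv {ρ η : ℝ} (hρ : 0 < ρ) (hη : η = 1 ∨ η = -1) :
    Real.sin (2 * Real.arctan (-η / ρ)) = -η * (2 * ρ / (ρ ^ 2 + 1)) := by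
  have h := Real.cos_arctan_pos (-η / ρ)
  rw [Real.sin_two_mul]
  have : Real.sin (Real.arctan (-η / ρ)) = (-η / ρ) * Real.cos (Real.arctan (-η / ρ)) := by
    rw [← Real.tan_mul_cos h.ne', Real.tan_arctan]
  rw [this, show 2 * (-η / ρ * Real.cos (Real.arctan (-η / ρ))) * Real.cos (Real.arctan (-η / ρ))
    = 2 * (-η / ρ) * Real.cos (Real.arctan (-η / ρ)) ^ 2 by ring, Real.cos_sq_arctan, div_pow,
    neg_sq, sign_sq hη]
  field_simp

/-! ### The intersection of two horospheres. -/

theorem eq_mul_I_of_orthogonal {x y : ℂ} (hx : x ≠ 0) (hn : Complex.normSq y = Complex.normSq x)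
    (ho : x.re * y.re + x.im * y.im = 0) :
    ∃ η : ℝ, (η = 1 ∨ η = -1) ∧ y = x * (η * Complex.I) := by
  -- After multiplication by the square of conj x, real and imaginary parts involve only the two
  -- norms and the inner product.
  have hsq : y ^ 2 = (x * Complex.I) ^ 2 := by
    have hc : (conj x) ^ 2 ≠ 0 := pow_ne_zero _ ((map_ne_zero _).2 hx)
    apply mul_right_cancel₀ hc
    rw [Complex.normSq_apply, Complex.normSq_apply] at hn
    apply Complex.ext <;> simp [pow_two]
    · linear_combination (2 * (x.re * y.re + x.im * y.im)) * ho
        - (x.re * x.re + x.im * x.im) * hn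
    · linear_combination (2 * (x.re * y.im - x.im * y.re)) * ho
  rcases sq_eq_sq_iff_eq_or_eq_neg.1 hsq with h | h
  · exact ⟨1, Or.inl rfl, by simpa using h⟩
  · exact ⟨-1, Or.inr rfl, by simpa using h⟩

theorem eq_zero_of_orthogonal {w x : ℂ} {η : ℝ} (hη : η = 1 ∨ η = -1) (hx : x ≠ 0)
    (h1 : w.re * x.re + w.im * x.im = 0)
    (h2 : w.re * (x * (η * Complex.I)).re + w.im * (x * (η * Complex.I)).im = 0) : w = 0 := by
  have : w * conj x = 0 := by
    apply Complex.ext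
    · simpa using h1
    · rcases hη with rfl | rfl <;> simp at h2 ⊢ <;> linarith
  simpa [hx] using this

/-- A circular arc in the intersection of two horospheres is a piece of an orbit of the rotations
around the geodesic that joins their points of tangency. -/
theorem exists_edgeForm {γ : CircArc} {T : Mat} {ri rj : ℝ} (hT : T.det ≠ 0) (hri : ri ≠ 0)
    (hrj : rj ≠ 0) (h : ∀ s, γ.pos s ∈ horosphere (sand T (herm ri 0 0)) ∩
      horosphere (sand T (herm 0 rj 0))) :
    ∃ (a b : ℝ) (β : ℂ) (η : ℝ), EdgeForm γ T a b β η ∧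
      ri * Complex.normSq T.det * b = 2 ∧ rj * Complex.normSq T.det * a = 2 ∧
      Complex.normSq T.det * (a * b - Complex.normSq β) = 1 := by
  have hD : Complex.normSq T.det ≠ 0 := (Complex.normSq_pos.2 hT).ne'
  obtain ⟨p1, p2, β, hp⟩ := exists_sand_herm hT γ.p_herm
  obtain ⟨q1, q2, χ, hq⟩ := exists_sand_herm hT γ.q_herm
  have hcH : γ.center.IsHermitian := by
    have h0 : γ.center = γ.pos 0 - γ.p := by simp [CircArc.pos]
    rw [h0]
    exact (h 0).1.1.1.sub γ.p_herm
  obtain ⟨a, b, ω, hc⟩ := exists_sand_herm hT hcH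
  have hpos (s : ℝ) : γ.pos s = sand T (herm (a + Real.cos s * p1 + Real.sin s * q1)
      (b + Real.cos s * p2 + Real.sin s * q2) (ω + Real.cos s * β + Real.sin s * χ)) := by
    rw [CircArc.pos, hc, hp, hq, ← sand_smul, ← sand_smul, ← sand_add, ← sand_add,
      real_smul_herm, real_smul_herm, herm_add, herm_add]
  have hI (s : ℝ) : ri * Complex.normSq T.det * (b + Real.cos s * p2 + Real.sin s * q2) = 2 := by
    have := (h s).1.2
    rw [hpos, mink_sand, mink_herm] at this
    simp at this
    linear_combination 2 * this
  have hJ (s : ℝ) : rj * Complex.normSq T.det * (a + Real.cos s * p1 + Real.sin s * q1) = 2 := by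
    have := (h s).2.2
    rw [hpos, mink_sand, mink_herm] at this
    simp at this
    linear_combination 2 * this
  have hi : ri * Complex.normSq T.det ≠ 0 := mul_ne_zero hri hD
  have hj : rj * Complex.normSq T.det ≠ 0 := mul_ne_zero hrj hD
  -- Each horosphere makes one diagonal entry constant. Constancy of c₀ + c₁ cos s + c₂ sin s,
  -- tested at 0, π and π/2, forces c₁ = c₂ = 0.
  have hI0 := hI 0
  have hIπ := hI Real.pi
  have hI2 := hI (Real.pi / 2)
  have hJ0 := hJ 0
  have hJπ := hJ Real.pi
  have hJ2 := hJ (Real.pi / 2)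
  simp only [Real.cos_zero, Real.sin_zero, Real.cos_pi, Real.sin_pi, Real.cos_pi_div_two,
    Real.sin_pi_div_two] at hI0 hIπ hI2 hJ0 hJπ hJ2
  have hp2 : p2 = 0 := mul_left_cancel₀ hi (by linear_combination hI0 / 2 - hIπ / 2)
  have hp1 : p1 = 0 := mul_left_cancel₀ hj (by linear_combination hJ0 / 2 - hJπ / 2)
  have hq2 : q2 = 0 := mul_left_cancel₀ hi (by linear_combination hI2 - hI0 / 2 - hIπ / 2)
  have hq1 : q1 = 0 := mul_left_cancel₀ hj (by linear_combination hJ2 - hJ0 / 2 - hJπ / 2)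
  subst hp1 hp2 hq1 hq2
  have hdet (s : ℝ) : Complex.normSq T.det *
      (a * b - Complex.normSq (ω + Real.cos s * β + Real.sin s * χ)) = 1 := by
    have := (h s).1.1.2.1
    rw [hpos, det_sand, det_herm, ← Complex.ofReal_mul] at this
    have := Complex.ofReal_injective (this.trans Complex.ofReal_one.symm)
    simpa using this
  have hpp := γ.pp_pos
  have hqq := γ.qq_eq
  have hpq := γ.pq_eq
  rw [hp, mink_sand, mink_herm] at hpp
  rw [hp, hq, mink_sand, mink_sand, mink_herm, mink_herm] at hqq
  rw [hp, hq, mink_sand, mink_herm] at hpq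
  have hβ : β ≠ 0 := by
    rintro rfl
    simp at hpp
  obtain ⟨η, hη, rfl⟩ := eq_mul_I_of_orthogonal (x := β) (y := χ) hβ
    (by
      rw [Complex.normSq_apply, Complex.normSq_apply]
      apply mul_left_cancel₀ hD
      linear_combination hqq)
    (mul_left_cancel₀ hD (by linear_combination hpq))
  -- The off-diagonal entry has constant modulus. Comparing opposite parameters shows that its
  -- centre ω is orthogonal to both β and iβ, so the circle is centred on the axis.
  have hd0 := hdet 0
  have hdπ := hdet Real.pi
  have hd2 := hdet (Real.pi / 2)
  have hd2' := hdet (-(Real.pi / 2))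
  simp only [Real.cos_zero, Real.sin_zero, Real.cos_pi, Real.sin_pi, Real.cos_pi_div_two,
    Real.sin_pi_div_two, Real.cos_neg, Real.sin_neg, Complex.ofReal_one, Complex.ofReal_zero,
    Complex.ofReal_neg, zero_mul, one_mul, add_zero, neg_mul] at hd0 hdπ hd2 hd2'
  have hω : ω = 0 := by
    apply eq_zero_of_orthogonal hη hβ
    · apply mul_left_cancel₀ hD
      simp only [Complex.normSq_apply, Complex.add_re, Complex.add_im, Complex.neg_re,
        Complex.neg_im] at hd0 hdπ ⊢
      linear_combination hdπ / 4 - hd0 / 4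
    · apply mul_left_cancel₀ hD
      generalize β * (η * Complex.I) = χ at hd2 hd2' ⊢
      simp only [Complex.normSq_apply, Complex.add_re, Complex.add_im, Complex.neg_re,
        Complex.neg_im] at hd2 hd2' ⊢
      linear_combination hd2' / 4 - hd2 / 4
  subst hω
  refine ⟨a, b, β, η, ⟨hc, hp, hq, hT, hβ, hη⟩, ?_, ?_, ?_⟩
  · linear_combination hI0
  · linear_combination hJ0
  · simpa using hd0

/-! ### Frames given by two column vectors. -/

/-- The matrix with columns `x` and `y`. -/
def colMat (x y : Fin 2 → ℂ) : Mat := !![x 0, y 0; x 1, y 1]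

theorem det_colMat (x y : Fin 2 → ℂ) : (colMat x y).det = x 0 * y 1 - y 0 * x 1 := by
  simp [colMat, Matrix.det_fin_two]

theorem mul_colMat (N : Mat) (x y : Fin 2 → ℂ) : N * colMat x y = colMat (N *ᵥ x) (N *ᵥ y) := by
  ext i j
  fin_cases i <;> fin_cases j <;>
    simp [colMat, Matrix.mul_apply, Matrix.mulVec, dotProduct, Fin.sum_univ_two]

theorem sand_colMat_left (x y : Fin 2 → ℂ) (r : ℝ) :
    sand (colMat x y) (herm r 0 0) = (r : ℂ) • vecMulVec x (fun k => conj (x k)) := by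
  ext i j
  fin_cases i <;> fin_cases j <;>
    simp [colMat, sand, herm, Matrix.mul_apply, vecMulVec, Fin.sum_univ_two] <;> ring

theorem sand_colMat_right (x y : Fin 2 → ℂ) (r : ℝ) :
    sand (colMat x y) (herm 0 r 0) = (r : ℂ) • vecMulVec y (fun k => conj (y k)) := by
  ext i j
  fin_cases i <;> fin_cases j <;>
    simp [colMat, sand, herm, Matrix.mul_apply, vecMulVec, Fin.sum_univ_two] <;> ring

/-- Serves to compare an edge with its reverse, whose frame has the columns exchanged. -/
theorem sand_colMat_swap (x y : Fin 2 → ℂ) (a b : ℝ) (β : ℂ) :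
    sand (colMat y x) (herm b a (conj β)) = sand (colMat x y) (herm a b β) := by
  ext i j
  fin_cases i <;> fin_cases j <;>
    simp [colMat, sand, herm, Matrix.mul_apply, Fin.sum_univ_two] <;> ring

/-- Opposite phases on the columns cancel on the diagonal and add up off it; hence half angles in
SL(2, ℂ) become full angles on the circle. -/
theorem sand_colMat_phase (x y : Fin 2 → ℂ) (a b : ℝ) (β : ℂ) (t : ℝ) :
    sand (colMat (phase (t / 2) • x) (phase (-(t / 2)) • y)) (herm a b β) =
      sand (colMat x y) (herm a b (β * phase t)) := by
  have h : phase t = phase (t / 2) * phase (t / 2) := by rw [← phase_add, add_halves]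
  have h1 := conj_phase (t / 2)
  have h2 := conj_phase (-(t / 2))
  have h3 := phase_mul_neg (t / 2)
  rw [neg_neg] at h2
  rw [h]
  generalize phase (t / 2) = u, phase (-(t / 2)) = v at *
  ext i j
  fin_cases i <;> fin_cases j <;>
    simp [colMat, sand, herm, Matrix.mul_apply, Fin.sum_univ_two, h1, h2]
  · linear_combination (x 0 * a * conj (x 0) + y 0 * b * conj (y 0)) * h3
  · linear_combination (x 0 * a * conj (x 1) + y 0 * b * conj (y 1)) * h3
  · linear_combination (x 1 * a * conj (x 0) + y 1 * b * conj (y 0)) * h3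
  · linear_combination (x 1 * a * conj (x 1) + y 1 * b * conj (y 1)) * h3

theorem sand_injective {T : Mat} (hT : T.det ≠ 0) {X Y : Mat} (h : sand T X = sand T Y) :
    X = Y := by
  have hu : IsUnit T.det := isUnit_iff_ne_zero.2 hT
  have := congrArg (sand T⁻¹) h
  rw [sand_sand, sand_sand, Matrix.nonsing_inv_mul _ hu] at this
  simpa [sand] using this

/-! ### Incidences of darts, and rotations with prescribed eigenvectors. -/

namespace TriSurface

variable {M : TriSurface}

theorem src_rot (d : M.Dart) : src (M.rot d) = src d :=
  Quotient.sound (Equiv.Perm.SameCycle.symm ⟨1, by simp⟩)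

theorem left_next (d : M.Dart) : left (M.next d) = left d :=
  Quotient.sound (Equiv.Perm.SameCycle.symm ⟨1, by simp⟩)

theorem left_rot (d : M.Dart) : left (M.rot d) = right d := left_next (M.opp d)

theorem src_next (d : M.Dart) : src (M.next d) = tgt d := by
  have := src_rot (M.opp d)
  rwa [rot, Equiv.Perm.mul_apply, M.opp_opp] at this

theorem tgt_opp (d : M.Dart) : tgt (M.opp d) = src d := by rw [tgt, M.opp_opp]

theorem right_opp (d : M.Dart) : right (M.opp d) = left d := by rw [right, M.opp_opp]

end TriSurface

theorem homog_ne_zero (z : OnePoint ℂ) : homog z ≠ 0 := by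
  intro h
  have h0 := congrFun h 0
  have h1 := congrFun h 1
  induction z using OnePoint.rec <;> simp [homog] at h0 h1

theorem bracket_ne_zero {z w : OnePoint ℂ} (h : z ≠ w) : bracket z w ≠ 0 := by
  induction z using OnePoint.rec <;> induction w using OnePoint.rec <;>
    simp [bracket, homog] at h ⊢
  exact sub_ne_zero.2 h

theorem colMat_mulVec (x y : Fin 2 → ℂ) (a b : ℂ) :
    colMat x y *ᵥ ![a, b] = a • x + b • y := by
  ext i
  fin_cases i <;> simp [colMat, Matrix.mulVec, dotProduct, Fin.sum_univ_two, mul_comm]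

theorem colMat_left (x y : Fin 2 → ℂ) : colMat x y *ᵥ ![1, 0] = x := by
  rw [colMat_mulVec, one_smul, zero_smul, add_zero]

theorem colMat_right (x y : Fin 2 → ℂ) : colMat x y *ᵥ ![0, 1] = y := by
  rw [colMat_mulVec, one_smul, zero_smul, zero_add]

/-- The matrix with eigenvectors `x` and `y` and eigenvalues `exp (± i t / 2)`. -/
def rotor (x y : Fin 2 → ℂ) (t : ℝ) : Mat :=
  colMat (phase (t / 2) • x) (phase (-(t / 2)) • y) * (colMat x y)⁻¹

section Rotor

variable {x y : Fin 2 → ℂ} (h : (colMat x y).det ≠ 0) (t : ℝ)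

include h

theorem rotor_mul_colMat :
    rotor x y t * colMat x y = colMat (phase (t / 2) • x) (phase (-(t / 2)) • y) := by
  rw [rotor, Matrix.mul_assoc, Matrix.nonsing_inv_mul _ (isUnit_iff_ne_zero.2 h), Matrix.mul_one]

theorem det_rotor : (rotor x y t).det = 1 := by
  have h1 := congrArg Matrix.det (rotor_mul_colMat h t)
  rw [Matrix.det_mul] at h1
  apply mul_right_cancel₀ h
  rw [h1, det_colMat, det_colMat]
  simp only [Pi.smul_apply, smul_eq_mul]
  linear_combination (x 0 * y 1 - y 0 * x 1) * phase_mul_neg (t / 2)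

theorem rotor_mulVec_left : rotor x y t *ᵥ x = phase (t / 2) • x := by
  have e := congrArg (· *ᵥ ![1, 0]) (rotor_mul_colMat h t)
  simpa only [← Matrix.mulVec_mulVec, colMat_left] using e

theorem rotor_mulVec_right : rotor x y t *ᵥ y = phase (-(t / 2)) • y := by
  have e := congrArg (· *ᵥ ![0, 1]) (rotor_mul_colMat h t)
  simpa only [← Matrix.mulVec_mulVec, colMat_right] using e

theorem det_colMat_swap : (colMat y x).det ≠ 0 := by
  rw [det_colMat] at h ⊢
  intro h'
  exact h (by linear_combination -h')

/-- Exchanging the eigenvectors exchanges the reciprocal eigenvalues, so the reversed edge carries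
the inverse rotation. -/
theorem rotor_swap_mul : rotor y x t * rotor x y t = 1 := by
  have h' := det_colMat_swap h
  have hu := isUnit_iff_ne_zero.2 h
  have e : rotor y x t * rotor x y t * colMat x y = colMat x y := by
    rw [Matrix.mul_assoc, rotor_mul_colMat h, mul_colMat, Matrix.mulVec_smul, Matrix.mulVec_smul,
      rotor_mulVec_left h', rotor_mulVec_right h', smul_smul, smul_smul, phase_mul_neg,
      mul_comm, phase_mul_neg, one_smul, one_smul]
  calc rotor y x t * rotor x y t
      = rotor y x t * rotor x y t * colMat x y * (colMat x y)⁻¹ := by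
        rw [Matrix.mul_assoc _ (colMat x y), Matrix.mul_nonsing_inv _ hu, Matrix.mul_one]
    _ = 1 := by rw [e, Matrix.mul_nonsing_inv _ hu]

theorem sand_rotor (a b : ℝ) (β : ℂ) : sand (rotor x y t) (sand (colMat x y) (herm a b β)) =
    sand (colMat x y) (herm a b (β * phase t)) := by
  rw [sand_sand, rotor_mul_colMat h, sand_colMat_phase]

end Rotor

/-! ### The rotation of each edge of a horospherical net. -/

namespace HorosphericalNet

variable {M : TriSurface} (S : HorosphericalNet M)

/-- Homogeneous coordinates of the end points of an edge under the Gauss map. -/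
def frame (d : M.Dart) : Mat :=
  colMat (homog (S.gauss (TriSurface.src d))) (homog (S.gauss (TriSurface.tgt d)))

theorem det_frame_ne_zero (d : M.Dart) : (S.frame d).det ≠ 0 := by
  rw [frame, det_colMat]
  exact bracket_ne_zero (S.gauss_delaunay.ne d)

/-- The length is ρ times the angle of the arc and tan(α/2) = -η/ρ, so the radius cancels and only
the signed rotation angle remains. -/
theorem exists_edge (d : M.Dart) : ∃ (a b : ℝ) (β : ℂ) (η : ℝ),
    EdgeForm (S.arc d) (S.frame d) a b β η ∧ S.edgeTerm d = -(η * (S.arc d).angle) := by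
  obtain ⟨ri, hri, hi⟩ := S.horo_gauss (TriSurface.src d)
  obtain ⟨rj, hrj, hj⟩ := S.horo_gauss (TriSurface.tgt d)
  rw [← sand_colMat_left _ (homog (S.gauss (TriSurface.tgt d)))] at hi
  rw [← sand_colMat_right (homog (S.gauss (TriSurface.src d)))] at hj
  have hm := S.arc_mem d
  rw [hi, hj] at hm
  obtain ⟨a, b, β, η, he, h1, h2, h3⟩ :=
    exists_edgeForm (S.det_frame_ne_zero d) hri.ne' hrj.ne' hm
  refine ⟨a, b, β, η, he, ?_⟩
  have hpos := he.normSq_pos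
  have hρ := Real.sqrt_pos.2 hpos
  have hsq := Real.sq_sqrt hpos.le
  have h0 : (0 : ℝ) ∈ Set.Icc 0 (S.arc d).angle := ⟨le_rfl, (S.arc d).angle_nonneg⟩
  have hc := S.cos_dihedral d 0 h0
  have hs := S.sin_dihedral d 0 h0
  rw [hi, hj] at hc hs
  have ht := tan_half_of_cos_sin hρ (hc.trans (he.mink_normal h1 h2 h3 0 hsq))
    (hs.trans (he.triple_normal h1 h2 h3 0 hρ hsq))
  rw [edgeTerm, length, he.length_eq]
  linear_combination (S.arc d).angle * ht

/-- Reversal conjugates the off-diagonal entry and runs the parameter backwards; the two sign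
changes cancel. The parametrizations agree for all real `s`, so this also covers arcs of angle zero.
-/
theorem sign_opp {d : M.Dart} {a b a' b' : ℝ} {β β' : ℂ} {η η' : ℝ}
    (h : EdgeForm (S.arc d) (S.frame d) a b β η)
    (h' : EdgeForm (S.arc (M.opp d)) (S.frame (M.opp d)) a' b' β' η') : η' = η := by
  have hf (s : ℝ) : conj (β' * phase (η' * s)) = β * phase (η * ((S.arc d).angle - s)) := by
    have e := S.arc_opp d s
    rw [h.pos_eq, h'.pos_eq, frame, TriSurface.tgt_opp, ← sand_colMat_swap, frame] at e
    have e2 := congrFun (congrFun (sand_injective (S.det_frame_ne_zero d) e) 0) 1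
    simpa [herm] using e2
  have e0 := hf 0
  have e1 := hf (Real.pi / 2)
  rw [mul_zero, phase_zero, mul_one, sub_zero] at e0
  rw [map_mul, e0, conj_phase, mul_sub, sub_eq_add_neg, phase_add, ← mul_assoc] at e1
  have e2 := mul_left_cancel₀ (mul_ne_zero h.ne_zero (phase_ne_zero _)) e1
  rcases h.sign with rfl | rfl <;> rcases h'.sign with rfl | rfl <;> try rfl
  all_goals
    exfalso
    have e3 := congrArg Complex.im e2
    simp [phase_eq] at e3
    linarith

/-- The rotations that carry each vertex of the net to its neighbours, keeping the horospheres. -/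
theorem exists_rotation : ∃ (η : M.Dart → ℝ) (R : M.Dart → SL2),
    (∀ d, η d = 1 ∨ η d = -1) ∧ (∀ d, η (M.opp d) = η d) ∧
    (∀ d, S.edgeTerm d = -(η d * (S.arc d).angle)) ∧
    (∀ d, (R d : Mat) *ᵥ homog (S.gauss (TriSurface.src d)) =
      phase (η d * (S.arc d).angle / 2) • homog (S.gauss (TriSurface.src d))) ∧
    (∀ d, (R d : Mat) *ᵥ homog (S.gauss (TriSurface.tgt d)) =
      phase (-(η d * (S.arc d).angle / 2)) • homog (S.gauss (TriSurface.tgt d))) ∧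
    (∀ d, R (M.opp d) * R d = 1) ∧
    ∀ d, S.point (TriSurface.right d) = sand (R d) (S.point (TriSurface.left d)) := by
  choose a b β η he ht using S.exists_edge
  have hη (d : M.Dart) : η (M.opp d) = η d := S.sign_opp (he d) (he (M.opp d))
  have hd (d : M.Dart) := S.det_frame_ne_zero d
  refine ⟨η, fun d => ⟨rotor (homog (S.gauss (TriSurface.src d)))
    (homog (S.gauss (TriSurface.tgt d))) (η d * (S.arc d).angle), det_rotor (hd d) _⟩,
    fun d => (he d).sign, hη, ht, fun d => rotor_mulVec_left (hd d) _,
    fun d => rotor_mulVec_right (hd d) _, fun d => ?_, fun d => ?_⟩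
  · apply Subtype.ext
    show rotor (homog (S.gauss (TriSurface.tgt d)))
      (homog (S.gauss (TriSurface.tgt (M.opp d)))) (η (M.opp d) * (S.arc (M.opp d)).angle) *
      rotor (homog (S.gauss (TriSurface.src d))) (homog (S.gauss (TriSurface.tgt d)))
        (η d * (S.arc d).angle) = 1
    rw [hη, S.arc_opp_angle, TriSurface.tgt_opp]
    exact rotor_swap_mul (hd d) _
  · rw [← S.arc_end, ← S.arc_start, (he d).pos_eq, (he d).pos_eq, mul_zero, phase_zero, mul_one]
    exact (sand_rotor (hd d) _ _ _ _).symm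

end HorosphericalNet

/-! ### Rigidity of isometries fixing a point inside and one on the boundary. -/

/-- Cholesky factorization: ab = 1 + |β|² and a + b > 0 make the corner entry positive. -/
theorem exists_eq_mul_conjTranspose {x : Mat} (hx : x ∈ hyperbolicSpace) :
    ∃ A : SL2, x = (A : Mat) * (A : Mat)ᴴ := by
  obtain ⟨hH, hd, ht⟩ := hx
  rw [eq_herm_of_isHermitian hH] at hd ht ⊢
  generalize (x 0 0).re = a, (x 1 1).re = b, x 0 1 = β at hd ht ⊢
  rw [det_herm] at hd
  have hd' : a * b - Complex.normSq β = 1 := by exact_mod_cast hd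
  have ht' : 0 < a + b := by simpa [herm, Matrix.trace_fin_two] using ht
  have ha : 0 < a := by
    have := Complex.normSq_nonneg β
    by_contra h
    nlinarith
  have hs := Real.sqrt_pos.2 ha
  have hsq : √a * √a = a := Real.mul_self_sqrt ha.le
  generalize √a = s at hs hsq
  have hsc : (s : ℂ) ≠ 0 := by exact_mod_cast hs.ne'
  refine ⟨⟨!![(s : ℂ), 0; conj β / s, (s : ℂ)⁻¹], by simp [Matrix.det_fin_two, hsc]⟩, ?_⟩
  have hb : (b : ℂ) = (Complex.normSq β + 1) / (s * s) := by
    rw [eq_div_iff (mul_ne_zero hsc hsc)]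
    exact_mod_cast show b * (s * s) = Complex.normSq β + 1 by rw [hsq]; linarith
  ext i j
  fin_cases i <;> fin_cases j <;>
    simp [herm, Matrix.mul_apply, Fin.sum_univ_two]
  · exact_mod_cast hsq.symm
  · field_simp
  · field_simp
  · rw [hb, ← Complex.mul_conj]
    field_simp

/-- A hyperbolic isometry that fixes a point of hyperbolic space and has a boundary fixed point
with eigenvalue `1` is trivial. -/
theorem eq_one_of_fixes {K : SL2} {h : Fin 2 → ℂ} {x : Mat} (hh : h ≠ 0)
    (hK : (K : Mat) *ᵥ h = h) (hx : x ∈ hyperbolicSpace) (hKx : sand K x = x) : K = 1 := by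
  obtain ⟨A, rfl⟩ := exists_eq_mul_conjTranspose hx
  have hdet : ((K : Mat) - 1).det = 0 :=
    Matrix.exists_mulVec_eq_zero_iff.1 ⟨h, hh, by rw [Matrix.sub_mulVec, hK]; simp⟩
  have htr : (K : Mat).trace = 2 := by
    have hKd := K.det_coe
    rw [Matrix.det_fin_two] at hKd hdet
    simp at hdet
    rw [Matrix.trace_fin_two]
    linear_combination hKd - hdet
  -- Since K fixes AA*, its conjugate U is unitary; an element of SU(2) with trace 2 is the
  -- identity.
  set U : SL2 := A⁻¹ * K * A with hU
  have hAU : A * U = K * A := by rw [hU]; group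
  have hUA : (A : Mat) * (U : Mat) = K * A := by
    exact_mod_cast congrArg (fun B : SL2 => (B : Mat)) hAU
  have hUtr : (U : Mat).trace = 2 := by
    rw [← htr, hU]
    simp only [Matrix.SpecialLinearGroup.coe_mul]
    rw [Matrix.trace_mul_comm, ← Matrix.mul_assoc, ← Matrix.SpecialLinearGroup.coe_mul,
      mul_inv_cancel, Matrix.SpecialLinearGroup.coe_one, Matrix.one_mul]
  have hAu : IsUnit (A : Mat) := by
    rw [Matrix.isUnit_iff_isUnit_det, A.det_coe]
    exact isUnit_one
  have hUU : (U : Mat) * (U : Mat)ᴴ = 1 := by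
    have e : (A : Mat) * ((U : Mat) * (U : Mat)ᴴ) * (A : Mat)ᴴ = A * 1 * (A : Mat)ᴴ := by
      rw [Matrix.mul_one, ← hKx, sand, ← Matrix.mul_assoc, hUA, Matrix.mul_assoc _ (U : Mat)ᴴ,
        ← Matrix.conjTranspose_mul, hUA, Matrix.conjTranspose_mul]
      simp only [Matrix.mul_assoc]
    have hAs : IsUnit (A : Mat)ᴴ := hAu.star
    exact hAu.mul_left_cancel (hAs.mul_right_cancel e)
  have hUu : IsUnit (U : Mat) := by
    rw [Matrix.isUnit_iff_isUnit_det, U.det_coe]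
    exact isUnit_one
  have hadj : (U : Mat)ᴴ = (U : Mat).adjugate :=
    hUu.mul_left_cancel (by rw [hUU, Matrix.mul_adjugate, U.det_coe, one_smul])
  have e00 := congrFun (congrFun hadj 1) 1
  have e10 := congrFun (congrFun hadj 0) 1
  have hUd := U.det_coe
  rw [Matrix.det_fin_two] at hUd
  rw [Matrix.trace_fin_two] at hUtr
  simp [Matrix.adjugate_fin_two] at e00 e10
  have h01 : (U : Mat) 0 1 = -conj ((U : Mat) 1 0) := by rw [e10, neg_neg]
  rw [← e00] at hUtr
  rw [← e00, h01] at hUd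
  generalize hp : (U : Mat) 1 1 = p, hq : (U : Mat) 1 0 = q at *
  have hre : p.re = 1 := by
    have := congrArg Complex.re hUtr
    simp at this
    linarith
  have hn : p.re * p.re + p.im * p.im + (q.re * q.re + q.im * q.im) = 1 := by
    have := congrArg Complex.re hUd
    simp at this
    linarith
  rw [hre] at hn
  have him : p.im = 0 := by nlinarith [mul_self_nonneg p.im, mul_self_nonneg q.re, mul_self_nonneg q.im]
  have hqre : q.re = 0 := by nlinarith [mul_self_nonneg p.im, mul_self_nonneg q.re, mul_self_nonneg q.im]
  have hqim : q.im = 0 := by nlinarith [mul_self_nonneg p.im, mul_self_nonneg q.re, mul_self_nonneg q.im]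
  have hp1 : p = 1 := Complex.ext hre him
  have hq0 : q = 0 := Complex.ext hqre hqim
  have hU1 : U = 1 := by
    ext i j
    fin_cases i <;> fin_cases j <;> simp [hp, hq, h01, ← e00, hp1, hq0]
  rw [hU1, mul_one] at hAU
  exact (mul_eq_right.1 hAU.symm)

/-! ### Vertex stars and dual paths. -/

namespace TriSurface

variable {M : TriSurface}

theorem src_rot_pow (d : M.Dart) (k : ℕ) : src ((M.rot ^ k) d) = src d := by
  induction k with
  | zero => rfl
  | succ k ih => rw [pow_succ', Equiv.Perm.mul_apply, src_rot, ih]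

theorem mem_star {d : M.Dart} {v : M.Vertex} : d ∈ star v ↔ src d = v := by
  simp [star]

theorem minimalPeriod_rot_pos (d : M.Dart) : 0 < Function.minimalPeriod M.rot d := by
  apply Function.minimalPeriod_pos_of_mem_periodicPts
  have hmaps : Set.MapsTo (fun k : ℕ => (M.rot ^ k) d) Set.univ {e | M.rot.SameCycle d e} :=
    fun k _ => ⟨k, by simp⟩
  obtain ⟨m, -, n, -, hmn, he⟩ := Set.infinite_univ.exists_lt_map_eq_of_mapsTo hmaps
    (M.finite_degree d)
  refine ⟨n - m, Nat.sub_pos_of_lt hmn, ?_⟩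
  rw [Function.IsPeriodicPt, Function.IsFixedPt, Equiv.Perm.iterate_eq_pow]
  apply (M.rot ^ m).injective
  rw [← Equiv.Perm.mul_apply, ← pow_add, Nat.add_sub_cancel' hmn.le]
  exact he.symm

theorem rot_pow_minimalPeriod (d : M.Dart) :
    (M.rot ^ Function.minimalPeriod M.rot d) d = d := by
  rw [← Equiv.Perm.iterate_eq_pow]
  exact Function.iterate_minimalPeriod

/-- The powers of `rot` below the minimal period enumerate the star without repetition, so angles
accumulated along `vertexLoop` are sums over the star. -/
theorem sum_star (d : M.Dart) (g : M.Dart → ℝ) :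
    ∑ k ∈ Finset.range (Function.minimalPeriod M.rot d), g ((M.rot ^ k) d) =
      ∑ e ∈ star (src d), g e := by
  refine Finset.sum_nbij (fun k => (M.rot ^ k) d) (fun k _ => mem_star.2 (src_rot_pow d k)) ?_ ?_
    fun _ _ => rfl
  · intro m hm n hn h
    refine Function.iterate_injOn_Iio_minimalPeriod (f := M.rot) (x := d) (by simpa using hm)
      (by simpa using hn) ?_
    simpa [Equiv.Perm.iterate_eq_pow] using h
  · intro e he
    have hs : src d = src e := (mem_star.1 he).symm
    obtain ⟨j, hj⟩ : M.rot.SameCycle d e := Quotient.exact hs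
    have hp : (0 : ℤ) < Function.minimalPeriod M.rot d := by exact_mod_cast minimalPeriod_rot_pos d
    have hmod : (M.rot ^ (j % (Function.minimalPeriod M.rot d : ℤ))) d = e := by
      rw [← hj]
      exact MulAction.zpow_mod_period_smul (g := M.rot) (a := d) j
    refine ⟨(j % (Function.minimalPeriod M.rot d : ℤ)).toNat, ?_, ?_⟩
    · have := Int.emod_lt_of_pos j hp
      have := Int.emod_nonneg j hp.ne'
      simp
      omega
    · have := Int.toNat_of_nonneg (Int.emod_nonneg j hp.ne')
      show (M.rot ^ (j % (Function.minimalPeriod M.rot d : ℤ)).toNat) d = e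
      rw [← hmod]
      conv_rhs => rw [← this, zpow_natCast]

/-- A function of darts that is invariant under rotation around the source depends on the source
only. -/
theorem eq_of_src_eq {X : Type*} {g : M.Dart → X} (hg : ∀ d, g (M.rot d) = g d) {d e : M.Dart}
    (h : src d = src e) : g d = g e := by
  obtain ⟨j, rfl⟩ : M.rot.SameCycle d e := Quotient.exact h
  clear h
  induction j with
  | zero => rfl
  | succ n ih => rw [ih, add_comm, _root_.zpow_add, zpow_one, Equiv.Perm.mul_apply, hg]
  | pred n ih =>
    rw [ih, ← hg ((M.rot ^ (-(n : ℤ) - 1)) d), ← Equiv.Perm.mul_apply, ← _root_.zpow_one_add]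
    congr 3
    ring

theorem IsDualPath.append {u v w : M.Face} {p q : List M.Dart} (hp : IsDualPath u p v)
    (hq : IsDualPath v q w) : IsDualPath u (p ++ q) w := by
  induction p generalizing u with
  | nil => exact (show u = v from hp) ▸ hq
  | cons d p ih => exact ⟨hp.1, ih hp.2⟩

end TriSurface

/-! ### Holonomy of the edge rotations. -/

section Holonomy

variable {M : TriSurface} (R : M.Dart → SL2)

/-- The product of transition matrices along an edge path of the dual mesh. -/
def hol : List M.Dart → SL2
  | [] => 1
  | d :: p => hol p * R d

theorem hol_append (p q : List M.Dart) : hol R (p ++ q) = hol R q * hol R p := by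
  induction p with
  | nil => simp [hol]
  | cons d p ih => simp [hol, ih, mul_assoc]

variable {R}

theorem sand_mul_coe (A B : SL2) (Y : Mat) :
    sand ((A * B : SL2) : Mat) Y = sand A (sand B Y) := by
  rw [sand_sand, Matrix.SpecialLinearGroup.coe_mul]

theorem sand_one (Y : Mat) : sand ((1 : SL2) : Mat) Y = Y := by
  simp [sand]

theorem hol_isDualPath {x : M.Face → Mat}
    (hx : ∀ d, x (TriSurface.right d) = sand (R d) (x (TriSurface.left d))) {u v : M.Face}
    {p : List M.Dart} (hp : TriSurface.IsDualPath u p v) : x v = sand (hol R p) (x u) := by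
  induction p generalizing u with
  | nil =>
    have : u = v := hp
    rw [this, hol, sand_one]
  | cons d p ih => rw [hol, sand_mul_coe, ← hp.1, ← hx, ih hp.2]

/-- Both elementary homotopies insert a loop of trivial holonomy. -/
theorem hol_eq_of_eqvGen (hR : ∀ d, R (M.opp d) * R d = 1)
    (hv : ∀ d, hol R (TriSurface.vertexLoop d) = 1) {P : List M.Dart → List M.Dart → Prop}
    (hP : ∀ p q, P p q → TriSurface.Step p q) {p q : List M.Dart} (h : Relation.EqvGen P p q) :
    hol R p = hol R q := by
  induction h with
  | rel p q h =>
    obtain ⟨a, b, d, rfl, rfl | rfl⟩ := hP _ _ h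
    · simp [hol_append, hol, mul_assoc, hR]
    · simp [hol_append, hv]
  | refl => rfl
  | symm _ _ _ ih => exact ih.symm
  | trans _ _ _ _ _ ih ih' => exact ih.trans ih'

theorem hol_eq_of_isDualPath (hM : M.SimplyConnected) (hR : ∀ d, R (M.opp d) * R d = 1)
    (hv : ∀ d, hol R (TriSurface.vertexLoop d) = 1) {u v : M.Face} {p q : List M.Dart}
    (hp : TriSurface.IsDualPath u p v) (hq : TriSurface.IsDualPath u q v) :
    hol R p = hol R q := by
  obtain ⟨c, hc⟩ := hM.1 v u
  have h1 (p : List M.Dart) (hp : TriSurface.IsDualPath u p v) : hol R c * hol R p = 1 := by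
    rw [← hol_append]
    exact hol_eq_of_eqvGen hR hv (fun _ _ h => h.2.2) (hM.2 u _ (hp.append hc))
  exact mul_left_cancel ((h1 p hp).trans (h1 q hq).symm)

/-- Transport a factor A₀ of the base point along any path; path independence gives the edge
relation. -/
theorem exists_transport (hM : M.SimplyConnected) (hR : ∀ d, R (M.opp d) * R d = 1)
    (hv : ∀ d, hol R (TriSurface.vertexLoop d) = 1) {x : M.Face → Mat}
    (hmem : ∀ u, x u ∈ hyperbolicSpace)
    (hx : ∀ d, x (TriSurface.right d) = sand (R d) (x (TriSurface.left d))) :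
    ∃ A : M.Face → SL2, (∀ d, A (TriSurface.right d) = R d * A (TriSurface.left d)) ∧
      ∀ u, x u = (A u : Mat) * (A u : Mat)ᴴ := by
  rcases isEmpty_or_nonempty M.Face with hE | ⟨⟨o⟩⟩
  · exact ⟨fun _ => 1, fun d => isEmptyElim (TriSurface.left d), fun u => isEmptyElim u⟩
  obtain ⟨A₀, hA₀⟩ := exists_eq_mul_conjTranspose (hmem o)
  choose p hp using hM.1 o
  refine ⟨fun u => hol R (p u) * A₀, fun d => ?_, fun u => ?_⟩
  · have h : TriSurface.IsDualPath o (p (TriSurface.left d) ++ [d]) (TriSurface.right d) :=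
      (hp _).append ⟨rfl, rfl⟩
    show hol R (p (TriSurface.right d)) * A₀ = R d * (hol R (p (TriSurface.left d)) * A₀)
    rw [hol_eq_of_isDualPath hM hR hv (hp _) h, hol_append, ← mul_assoc]
    simp [hol]
  · rw [hol_isDualPath hx (hp u), hA₀, sand, Matrix.SpecialLinearGroup.coe_mul,
      Matrix.conjTranspose_mul]
    simp only [Matrix.mul_assoc]

/-- The holonomy around a vertex is trivial if the rotation angles add up to zero. -/
theorem hol_vertexLoop {θ : M.Dart → ℝ} {h : M.Vertex → Fin 2 → ℂ} {x : M.Face → Mat}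
    (hh : ∀ v, h v ≠ 0)
    (hR : ∀ d, (R d : Mat) *ᵥ h (TriSurface.src d) = phase (θ d / 2) • h (TriSurface.src d))
    (hmem : ∀ u, x u ∈ hyperbolicSpace)
    (hx : ∀ d, x (TriSurface.right d) = sand (R d) (x (TriSurface.left d)))
    (hsum : ∀ v, ∑ d ∈ TriSurface.star v, θ d = 0) (d : M.Dart) :
    hol R (TriSurface.vertexLoop d) = 1 := by
  -- After n crossings the common eigenvector has collected the partial angle sum, and the point has
  -- moved n steps along the dual face.
  have key (n : ℕ) :
      (hol R ((List.range n).map fun k => (M.rot ^ k) d) : Mat) *ᵥ h (TriSurface.src d) =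
        phase ((∑ k ∈ Finset.range n, θ ((M.rot ^ k) d)) / 2) • h (TriSurface.src d) ∧
      sand (hol R ((List.range n).map fun k => (M.rot ^ k) d)) (x (TriSurface.left d)) =
        x (TriSurface.left ((M.rot ^ n) d)) := by
    induction n with
    | zero => simp [hol, phase_zero, sand]
    | succ n ih =>
      have e := hR ((M.rot ^ n) d)
      rw [TriSurface.src_rot_pow] at e
      rw [List.range_succ, List.map_append, hol_append]
      simp only [List.map_cons, List.map_nil, hol, one_mul]
      constructor
      · rw [Matrix.SpecialLinearGroup.coe_mul, ← Matrix.mulVec_mulVec, ih.1, Matrix.mulVec_smul, e,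
          smul_smul, ← phase_add, Finset.sum_range_succ, add_div]
      · rw [sand_mul_coe, ih.2, ← hx, pow_succ', Equiv.Perm.mul_apply, TriSurface.left_rot]
  obtain ⟨h1, h2⟩ := key (Function.minimalPeriod M.rot d)
  rw [TriSurface.sum_star, hsum, zero_div, phase_zero, one_smul] at h1
  rw [TriSurface.rot_pow_minimalPeriod] at h2
  exact eq_one_of_fixes (hh _) h1 (hmem _) h2

end Holonomy

/-! ### Homogeneous vectors, determinants and arguments. -/

theorem exists_eq_smul_homog {m : Fin 2 → ℂ} (hm : m ≠ 0) :
    ∃ (z : OnePoint ℂ) (c : ℂ), c ≠ 0 ∧ m = c • homog z := by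
  by_cases h : m 1 = 0
  · refine ⟨OnePoint.infty, m 0, fun h0 => hm ?_, ?_⟩
    · ext i
      fin_cases i <;> simp [h, h0]
    · ext i
      fin_cases i <;> simp [homog, h]
  · refine ⟨((m 0 / m 1 : ℂ) : OnePoint ℂ), m 1, h, ?_⟩
    ext i
    fin_cases i <;> simp [homog]
    field_simp

theorem coe_inv_mulVec_coe_mulVec (A : SL2) (x : Fin 2 → ℂ) :
    ((A⁻¹ : SL2) : Mat) *ᵥ ((A : Mat) *ᵥ x) = x := by
  rw [Matrix.mulVec_mulVec, ← Matrix.SpecialLinearGroup.coe_mul, inv_mul_cancel,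
    Matrix.SpecialLinearGroup.coe_one, Matrix.one_mulVec]

theorem coe_mulVec_coe_inv_mulVec (A : SL2) (x : Fin 2 → ℂ) :
    (A : Mat) *ᵥ (((A⁻¹ : SL2) : Mat) *ᵥ x) = x := by
  rw [Matrix.mulVec_mulVec, ← Matrix.SpecialLinearGroup.coe_mul, mul_inv_cancel,
    Matrix.SpecialLinearGroup.coe_one, Matrix.one_mulVec]

theorem coe_mulVec_ne_zero (A : SL2) {x : Fin 2 → ℂ} (hx : x ≠ 0) : (A : Mat) *ᵥ x ≠ 0 := by
  intro h
  rw [← coe_inv_mulVec_coe_mulVec A x, h, Matrix.mulVec_zero] at hx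
  exact hx rfl

/-- The determinant of two vectors. -/
def wedge (x y : Fin 2 → ℂ) : ℂ := x 0 * y 1 - y 0 * x 1

theorem wedge_smul_smul (a b : ℂ) (x y : Fin 2 → ℂ) :
    wedge (a • x) (b • y) = a * b * wedge x y := by
  simp [wedge]
  ring

theorem wedge_mulVec (A : SL2) (x y : Fin 2 → ℂ) :
    wedge ((A : Mat) *ᵥ x) ((A : Mat) *ᵥ y) = wedge x y := by
  have h := A.det_coe
  rw [Matrix.det_fin_two] at h
  simp [wedge, Matrix.mulVec, dotProduct, Fin.sum_univ_two]
  linear_combination (x 0 * y 1 - y 0 * x 1) * h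

theorem arg_mul_phase {x : ℂ} {t : ℝ} (hx : x ≠ 0) (h0 : 0 ≤ x.arg + t)
    (hπ : x.arg + t < Real.pi) : (x * phase t).arg = x.arg + t := by
  have e : x * phase t = (‖x‖ : ℝ) *
      (Complex.cos ((x.arg + t : ℝ) : ℂ) + Complex.sin ((x.arg + t : ℝ) : ℂ) * Complex.I) := by
    conv_lhs => rw [← Complex.norm_mul_exp_arg_mul_I x]
    rw [← Complex.exp_mul_I, phase, mul_assoc, ← Complex.exp_add]
    push_cast
    ring_nf
  rw [e, Complex.arg_mul_cos_add_sin_mul_I (norm_pos_iff.2 hx)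
    ⟨by linarith [Real.pi_pos], hπ.le⟩]

/-! ### The circle pattern obtained from a transported frame. -/

section Pattern

variable {M : TriSurface}

theorem TriSurface.tgt_next (d : M.Dart) : tgt (M.next d) = apex d := (src_next _).symm

theorem TriSurface.tgt_next_next (d : M.Dart) : tgt (M.next (M.next d)) = src d := by
  rw [← src_next, M.next_next_next]

theorem crossRatio_ne_zero {w : M.Vertex → OnePoint ℂ} (hw : IsDelaunay w) (d : M.Dart) :
    crossRatio w d ≠ 0 := by
  have h (d : M.Dart) := bracket_ne_zero (hw.ne d)
  have h1 := h (M.next (M.next d))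
  have h2 := h (M.next (M.next (M.opp d)))
  have h3 := h (M.next (M.opp d))
  have h4 := h (M.next d)
  rw [TriSurface.tgt_next_next] at h1 h2
  rw [TriSurface.tgt_next, TriSurface.src_next] at h3 h4
  rw [TriSurface.tgt_opp] at h3
  exact div_ne_zero (mul_ne_zero (by norm_num) (mul_ne_zero h1 h2)) (mul_ne_zero h3 h4)

variable {h : M.Vertex → Fin 2 → ℂ} {C : M.Face → SL2} {θ : M.Dart → ℝ}
  (hC : ∀ d, (C (TriSurface.right d) : Mat) *ᵥ h (TriSurface.src d) =
    phase (-(θ d / 2)) • (C (TriSurface.left d) : Mat) *ᵥ h (TriSurface.src d))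

include hC

/-- The reversed dart exchanges the two triangles, which inverts the phase. -/
theorem transition_tgt (hθ : ∀ d, θ (M.opp d) = θ d) (d : M.Dart) :
    (C (TriSurface.right d) : Mat) *ᵥ h (TriSurface.tgt d) =
      phase (θ d / 2) • (C (TriSurface.left d) : Mat) *ᵥ h (TriSurface.tgt d) := by
  have e := hC (M.opp d)
  rw [TriSurface.right_opp, hθ] at e
  change _ = phase (-(θ d / 2)) • (C (TriSurface.right d) : Mat) *ᵥ h (TriSurface.tgt d) at e
  change (C (TriSurface.left d) : Mat) *ᵥ h (TriSurface.tgt d) = _ at e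
  rw [e, smul_smul, phase_mul_neg, one_smul]

/-- Turning around a vertex multiplies the image vector by a phase only, so its projective class
depends on the vertex alone. -/
theorem exists_pattern (hh : ∀ v, h v ≠ 0) : ∃ z : M.Vertex → OnePoint ℂ, ∀ d, ∃ c : ℂ, c ≠ 0 ∧
    (C (TriSurface.left d) : Mat) *ᵥ h (TriSurface.src d) = c • homog (z (TriSurface.src d)) := by
  have hm (v : M.Vertex) := exists_eq_smul_homog
    (coe_mulVec_ne_zero (C (TriSurface.left (Quotient.out v))) (hh v))
  choose z hz using hm
  refine ⟨z, fun d => ?_⟩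
  have hout : TriSurface.src (Quotient.out (TriSurface.src d)) = TriSurface.src d :=
    Quotient.out_eq _
  have hg := TriSurface.eq_of_src_eq (M := M) (g := fun e => ∃ c : ℂ, c ≠ 0 ∧
    (C (TriSurface.left e) : Mat) *ᵥ h (TriSurface.src e) = c • homog (z (TriSurface.src d)))
    (fun e => ?_) hout
  · refine hg.mp ?_
    obtain ⟨c, hc, he⟩ := hz (TriSurface.src d)
    refine ⟨c, hc, ?_⟩
    show _ *ᵥ h (TriSurface.src (Quotient.out (TriSurface.src d))) = _
    rw [hout]
    exact he
  · rw [TriSurface.left_rot, TriSurface.src_rot, hC]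
    apply propext
    constructor
    · rintro ⟨c, hc, he⟩
      refine ⟨phase (θ e / 2) * c, mul_ne_zero (phase_ne_zero _) hc, ?_⟩
      rw [mul_smul, ← he, smul_smul, phase_mul_neg, one_smul]
    · rintro ⟨c, hc, he⟩
      exact ⟨phase (-(θ e / 2)) * c, mul_ne_zero (phase_ne_zero _) hc, by rw [mul_smul, ← he]⟩

variable {w z : M.Vertex → OnePoint ℂ} (hw : ∀ v, h v = homog (w v))
  (hz : ∀ d, ∃ c : ℂ, c ≠ 0 ∧ (C (TriSurface.left d) : Mat) *ᵥ h (TriSurface.src d) =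
    c • homog (z (TriSurface.src d)))
  (hθ : ∀ d, θ (M.opp d) = θ d)

include hw hz hθ

/-- Determinants are SL(2, ℂ)-invariant: brackets with the left apex are computed in the left
triangle, those with the right apex in the right one. All scale factors cancel except the phases
exp(iθ/2) of j in the numerator and exp(-iθ/2) of i in the denominator. -/
theorem crossRatio_eq_mul_phase (d : M.Dart) :
    crossRatio z d = crossRatio w d * phase (-θ d) := by
  obtain ⟨ci, hci, hi⟩ := hz d
  obtain ⟨cj, hcj, hj⟩ := hz (M.next d)
  obtain ⟨ck, hck, hk⟩ := hz (M.next (M.next d))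
  obtain ⟨cl, hcl, hl⟩ := hz (M.next (M.next (M.opp d)))
  rw [TriSurface.left_next, TriSurface.src_next] at hj
  rw [TriSurface.left_next, TriSurface.left_next] at hk hl
  change (C (TriSurface.right d) : Mat) *ᵥ h (TriSurface.apex (M.opp d)) =
    cl • homog (z (TriSurface.apex (M.opp d))) at hl
  change _ *ᵥ h (TriSurface.apex d) = ck • homog (z (TriSurface.apex d)) at hk
  have hri := hC d
  have hrj := transition_tgt hC hθ d
  rw [hi, smul_smul] at hri
  rw [hj, smul_smul] at hrj
  have hb (u v : OnePoint ℂ) : bracket u v = wedge (homog u) (homog v) := rfl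
  have e1 := wedge_mulVec (C (TriSurface.left d)) (h (TriSurface.apex d)) (h (TriSurface.src d))
  have e2 := wedge_mulVec (C (TriSurface.right d)) (h (TriSurface.apex (M.opp d)))
    (h (TriSurface.tgt d))
  have e3 := wedge_mulVec (C (TriSurface.right d)) (h (TriSurface.src d))
    (h (TriSurface.apex (M.opp d)))
  have e4 := wedge_mulVec (C (TriSurface.left d)) (h (TriSurface.tgt d)) (h (TriSurface.apex d))
  rw [hi, hk, wedge_smul_smul, hw, hw, ← hb, ← hb] at e1
  rw [hl, hrj, wedge_smul_smul, hw, hw, ← hb, ← hb] at e2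
  rw [hri, hl, wedge_smul_smul, hw, hw, ← hb, ← hb] at e3
  rw [hj, hk, wedge_smul_smul, hw, hw, ← hb, ← hb] at e4
  have hψ : phase (-θ d) = phase (-(θ d / 2)) * phase (-(θ d / 2)) := by
    rw [← phase_add]
    ring_nf
  have hφ := phase_mul_neg (θ d / 2)
  have hφ0 := phase_ne_zero (θ d / 2)
  have hψ0 := phase_ne_zero (-(θ d / 2))
  simp only [crossRatio]
  rw [← e1, ← e2, ← e3, ← e4, hψ]
  generalize phase (θ d / 2) = φ, phase (-(θ d / 2)) = ψ at *
  generalize bracket (z (TriSurface.apex d)) (z (TriSurface.src d)) = b1,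
    bracket (z (TriSurface.apex (M.opp d))) (z (TriSurface.tgt d)) = b2,
    bracket (z (TriSurface.src d)) (z (TriSurface.apex (M.opp d))) = b3,
    bracket (z (TriSurface.tgt d)) (z (TriSurface.apex d)) = b4
  have e : (-1) * (ck * ci * b1 * (cl * (φ * cj) * b2)) / (ψ * ci * cl * b3 * (cj * ck * b4)) *
      (ψ * ψ) = (ci * cj * ck * cl * ψ) * ((φ * ψ) * (-1 * (b1 * b2))) /
        ((ci * cj * ck * cl * ψ) * (b3 * b4)) := by
    rw [div_mul_eq_mul_div]
    congr 1 <;> ring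
  rw [e, mul_div_mul_left _ _ (by simp [hci, hcj, hck, hcl, hψ0]), hφ, one_mul]

theorem arg_crossRatio_eq (hD : IsDelaunay w) (h0 : ∀ d, 0 ≤ -θ d + (crossRatio w d).arg)
    (hπ : ∀ d, -θ d + (crossRatio w d).arg < Real.pi) (d : M.Dart) :
    (crossRatio z d).arg = (crossRatio w d).arg + -θ d := by
  rw [crossRatio_eq_mul_phase hC hw hz hθ]
  exact arg_mul_phase (crossRatio_ne_zero hD d) (by linarith [h0 d]) (by linarith [hπ d])

theorem isDelaunay_of_transition (hD : IsDelaunay w)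
    (h0 : ∀ d, 0 ≤ -θ d + (crossRatio w d).arg) (hπ : ∀ d, -θ d + (crossRatio w d).arg < Real.pi)
    (hsum : ∀ v, ∑ d ∈ TriSurface.star v, θ d = 0) : IsDelaunay z := by
  have harg := arg_crossRatio_eq hC hw hz hθ hD h0 hπ
  refine ⟨fun d he => ?_, fun d => ?_, fun d => ?_, fun v => ?_⟩
  · obtain ⟨ci, -, hi⟩ := hz d
    obtain ⟨cj, -, hj⟩ := hz (M.next d)
    rw [TriSurface.left_next, TriSurface.src_next] at hj
    have e := wedge_mulVec (C (TriSurface.left d)) (h (TriSurface.src d)) (h (TriSurface.tgt d))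
    rw [hi, hj, wedge_smul_smul, he, hw, hw] at e
    refine bracket_ne_zero (hD.ne d) (e.symm.trans ?_)
    rw [wedge]
    ring
  · linarith [harg d, h0 d]
  · linarith [harg d, hπ d]
  · simp only [harg, Finset.sum_add_distrib, Finset.sum_neg_distrib, hsum, hD.sum_arg]
    ring

end Pattern

/-! ### Gram matrices: the base point 1 in a frame. -/

/-- The squared Hermitian length of a vector. -/
def sqLen (x : Fin 2 → ℂ) : ℝ := Complex.normSq (x 0) + Complex.normSq (x 1)

theorem sqLen_pos {x : Fin 2 → ℂ} (hx : x ≠ 0) : 0 < sqLen x := by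
  have h0 := Complex.normSq_nonneg (x 0)
  have h1 := Complex.normSq_nonneg (x 1)
  by_contra h
  apply hx
  ext i
  rw [sqLen] at h
  have e0 : x 0 = 0 := Complex.normSq_eq_zero.1 (by linarith)
  have e1 : x 1 = 0 := Complex.normSq_eq_zero.1 (by linarith)
  fin_cases i
  · exact e0
  · exact e1

/-- The Hermitian product of two vectors. -/
def hermProd (x y : Fin 2 → ℂ) : ℂ := x ⬝ᵥ fun k => conj (y k)

theorem hermProd_swap (x y : Fin 2 → ℂ) : hermProd y x = conj (hermProd x y) := by
  simp [hermProd, dotProduct, Fin.sum_univ_two, mul_comm]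

/-- The upper right entry of the inverse Gram matrix of two vectors. -/
def gramOff (x y : Fin 2 → ℂ) : ℂ :=
  ((Complex.normSq (colMat x y).det)⁻¹ : ℝ) * -hermProd y x

/-- The diagonal entry of the inverse Gram matrix of two vectors that belongs to the first one. -/
def gramDiag (x y : Fin 2 → ℂ) : ℝ := (Complex.normSq (colMat x y).det)⁻¹ * sqLen y

theorem normSq_det_colMat_swap (x y : Fin 2 → ℂ) :
    Complex.normSq (colMat y x).det = Complex.normSq (colMat x y).det := by
  rw [← Complex.normSq_neg, det_colMat, det_colMat]
  congr 1
  ring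

theorem gramOff_swap (x y : Fin 2 → ℂ) : gramOff y x = conj (gramOff x y) := by
  rw [gramOff, gramOff, normSq_det_colMat_swap, hermProd_swap y x]
  simp

/-- For T = `colMat x y` the inverse of T*T gives the coordinates of the point 1 in the frame T. Its
off-diagonal entry vanishes exactly when x and y are orthogonal, that is, when 1 lies on the
geodesic between them. -/
theorem sand_colMat_gram {x y : Fin 2 → ℂ} (h : (colMat x y).det ≠ 0) :
    sand (colMat x y) (herm (gramDiag x y) (gramDiag y x) (gramOff x y)) = 1 := by
  have hD : ((Complex.normSq (colMat x y).det : ℝ) : ℂ) ≠ 0 := by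
    exact_mod_cast (Complex.normSq_pos.2 h).ne'
  rw [gramDiag, gramDiag, gramOff, normSq_det_colMat_swap x y, ← real_smul_herm, sand_smul,
    Complex.ofReal_inv, inv_smul_eq_iff₀ hD]
  ext i j
  fin_cases i <;> fin_cases j <;>
    simp [colMat, sand, herm, Matrix.mul_apply, Fin.sum_univ_two, hermProd, dotProduct, sqLen,
      Matrix.det_fin_two, ← Complex.mul_conj] <;> ring

theorem det_gram {x y : Fin 2 → ℂ} (h : (colMat x y).det ≠ 0) :
    Complex.normSq (colMat x y).det *
      (gramDiag x y * gramDiag y x - Complex.normSq (gramOff x y)) = 1 := by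
  have e := congrArg Matrix.det (sand_colMat_gram h)
  rw [det_sand, det_herm, Matrix.det_one] at e
  exact_mod_cast e

theorem mem_hyperbolicSpace_of_det {N : Mat} (hN : N.det = 1) : sand N 1 ∈ hyperbolicSpace := by
  refine ⟨isHermitian_sand N Matrix.isHermitian_one, by simp [det_sand, hN], ?_⟩
  have e : (sand N 1).trace.re = Complex.normSq (N 0 0) + Complex.normSq (N 0 1) +
      (Complex.normSq (N 1 0) + Complex.normSq (N 1 1)) := by
    simp [sand, Matrix.trace_fin_two, Matrix.mul_apply, Fin.sum_univ_two, Complex.normSq_apply]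
  rw [e]
  by_contra h
  have h0 := Complex.normSq_nonneg (N 0 0)
  have h1 := Complex.normSq_nonneg (N 0 1)
  have h2 := Complex.normSq_nonneg (N 1 0)
  have h3 := Complex.normSq_nonneg (N 1 1)
  have h00 : N 0 0 = 0 := Complex.normSq_eq_zero.1 (by linarith)
  have h01 : N 0 1 = 0 := Complex.normSq_eq_zero.1 (by linarith)
  rw [Matrix.det_fin_two, h00, h01] at hN
  simp at hN

/-! ### Construction of the dual net. -/

/-- The arc `s ↦ sand T (herm a b (β * phase (η * s)))`. -/
def frameArc (T : Mat) (a b : ℝ) (β : ℂ) (η φ : ℝ) (hT : T.det ≠ 0) (hβ : β ≠ 0)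
    (hη : η = 1 ∨ η = -1) (h0 : 0 ≤ φ) (hπ : φ ≤ Real.pi) : CircArc where
  center := sand T (herm a b 0)
  p := sand T (herm 0 0 β)
  q := sand T (herm 0 0 (β * (η * Complex.I)))
  angle := φ
  p_herm := isHermitian_sand T (isHermitian_herm _ _ _)
  q_herm := isHermitian_sand T (isHermitian_herm _ _ _)
  pp_pos := by
    have h := mul_pos (Complex.normSq_pos.2 hT) (Complex.normSq_pos.2 hβ)
    rw [Complex.normSq_apply β] at h
    rw [mink_sand, mink_herm]
    linarith
  qq_eq := by
    rw [mink_sand, mink_sand, mink_herm, mink_herm]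
    rcases hη with rfl | rfl <;> simp <;> ring_nf <;> simp
  pq_eq := by
    rw [mink_sand, mink_herm]
    rcases hη with rfl | rfl <;> simp <;> ring_nf <;> simp
  angle_nonneg := h0
  angle_le := hπ

theorem edgeForm_frameArc {T : Mat} (a b : ℝ) {β : ℂ} {η φ : ℝ} (hT : T.det ≠ 0) (hβ : β ≠ 0)
    (hη : η = 1 ∨ η = -1) (h0 : 0 ≤ φ) (hπ : φ ≤ Real.pi) :
    EdgeForm (frameArc T a b β η φ hT hβ hη h0 hπ) T a b β η :=
  ⟨rfl, rfl, rfl, hT, hβ, hη⟩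

theorem det_mul_colMat (N : SL2) (x y : Fin 2 → ℂ) :
    (colMat ((N : Mat) *ᵥ x) ((N : Mat) *ᵥ y)).det = (colMat x y).det := by
  rw [← mul_colMat, Matrix.det_mul, N.det_coe, one_mul]

theorem vecMulVec_phase_smul (t : ℝ) (x : Fin 2 → ℂ) :
    vecMulVec (phase t • x) (fun k => conj ((phase t • x) k)) =
      vecMulVec x (fun k => conj (x k)) := by
  ext i j
  simp only [vecMulVec_apply, Pi.smul_apply, smul_eq_mul, map_mul, conj_phase]
  linear_combination (x i * conj (x j)) * phase_mul_neg t

variable {M : TriSurface}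

/-- A horospherical net with vertices `C C*` whose edges are rotated by the angles `-θ`. -/
theorem exists_net {z : M.Vertex → OnePoint ℂ} (hzD : IsDelaunay z) {C : M.Face → SL2}
    {k : M.Vertex → Fin 2 → ℂ} {η φ : M.Dart → ℝ} (hk : ∀ v, k v ≠ 0)
    (hη : ∀ d, η d = 1 ∨ η d = -1) (hηo : ∀ d, η (M.opp d) = η d)
    (h0 : ∀ d, 0 ≤ φ d) (hπ : ∀ d, φ d ≤ Real.pi) (hφo : ∀ d, φ (M.opp d) = φ d)
    (hC : ∀ d, (C (TriSurface.right d) : Mat) *ᵥ k (TriSurface.src d) =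
      phase (-(η d * φ d / 2)) • (C (TriSurface.left d) : Mat) *ᵥ k (TriSurface.src d))
    (hz : ∀ d, ∃ c : ℂ, c ≠ 0 ∧ (C (TriSurface.left d) : Mat) *ᵥ k (TriSurface.src d) =
      c • homog (z (TriSurface.src d)))
    (hind : ∀ d, (colMat (k (TriSurface.src d)) (k (TriSurface.tgt d))).det ≠ 0)
    (hno : ∀ d : M.Dart, hermProd (k (TriSurface.src d)) (k (TriSurface.tgt d)) ≠ 0) :
    ∃ g : HorosphericalNet M, g.gauss = z ∧ (∀ u, g.point u = (C u : Mat) * (C u : Mat)ᴴ) ∧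
      ∀ d, g.edgeTerm d = η d * φ d := by
  have hCt := transition_tgt (θ := fun d => η d * φ d) hC (fun d => by rw [hηo, hφo])
  have hη' (d : M.Dart) : -η d = 1 ∨ -η d = -1 := by
    rcases hη d with h | h <;> simp [h]
  -- the frame of an edge
  obtain ⟨x, hx⟩ : ∃ x : M.Dart → Fin 2 → ℂ, x = fun d => k (TriSurface.src d) := ⟨_, rfl⟩
  obtain ⟨y, hy⟩ : ∃ y : M.Dart → Fin 2 → ℂ, y = fun d => k (TriSurface.tgt d) := ⟨_, rfl⟩
  have hxo (d : M.Dart) : x (M.opp d) = y d := by rw [hx, hy]; rfl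
  have hyo (d : M.Dart) : y (M.opp d) = x d := by
    simp only [hx, hy, TriSurface.tgt_opp]
  have hdx (d : M.Dart) : (colMat (x d) (y d)).det ≠ 0 := by simpa only [hx, hy] using hind d
  have hCx (d : M.Dart) : (C (TriSurface.right d) : Mat) *ᵥ x d =
      phase (-(η d * φ d / 2)) • (C (TriSurface.left d) : Mat) *ᵥ x d := by rw [hx]; exact hC d
  have hCy (d : M.Dart) : (C (TriSurface.right d) : Mat) *ᵥ y d =
      phase (η d * φ d / 2) • (C (TriSurface.left d) : Mat) *ᵥ y d := by rw [hy]; exact hCt d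
  have hx0 (d : M.Dart) : x d ≠ 0 := by rw [hx]; exact hk _
  have hy0 (d : M.Dart) : y d ≠ 0 := by rw [hy]; exact hk _
  obtain ⟨T, hT⟩ : ∃ T : M.Dart → Mat, T = fun d =>
    colMat ((C (TriSurface.left d) : Mat) *ᵥ x d) ((C (TriSurface.left d) : Mat) *ᵥ y d) := ⟨_, rfl⟩
  have hTd (d : M.Dart) : (T d).det = (colMat (x d) (y d)).det := by
    rw [hT]
    exact det_mul_colMat _ _ _
  have hTne (d : M.Dart) : (T d).det ≠ 0 := by rw [hTd]; exact hdx d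
  -- Non-antipodality gives the circle positive radius.
  have hβ (d : M.Dart) : gramOff (x d) (y d) ≠ 0 := by
    refine mul_ne_zero ?_ (neg_ne_zero.2 ?_)
    · exact_mod_cast inv_ne_zero (Complex.normSq_pos.2 (hdx d)).ne'
    · rw [hermProd_swap, hx, hy]
      exact (map_ne_zero _).2 (hno d)
  -- The sign is -η because `C` transforms by the inverse phases.
  obtain ⟨arc, harc⟩ : ∃ arc : M.Dart → CircArc, arc = fun d =>
    frameArc (T d) (gramDiag (x d) (y d)) (gramDiag (y d) (x d)) (gramOff (x d) (y d)) (-η d) (φ d)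
      (hTne d) (hβ d) (hη' d) (h0 d) (hπ d) := ⟨_, rfl⟩
  have hform (d : M.Dart) : EdgeForm (arc d) (T d) (gramDiag (x d) (y d)) (gramDiag (y d) (x d))
      (gramOff (x d) (y d)) (-η d) := by
    rw [harc]
    exact edgeForm_frameArc _ _ _ _ _ _ _
  have hangle (d : M.Dart) : (arc d).angle = φ d := by rw [harc]; rfl
  have hpos (d : M.Dart) (s : ℝ) : (arc d).pos s =
      sand (C (TriSurface.left d) * rotor (x d) (y d) (-η d * s)) 1 := by
    rw [(hform d).pos_eq, hT]
    simp only
    rw [← mul_colMat, ← sand_sand, ← sand_rotor (hdx d), sand_colMat_gram (hdx d), sand_sand]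
  have hstart (d : M.Dart) : (arc d).pos 0 = sand (C (TriSurface.left d)) 1 := by
    rw [(hform d).pos_eq, hT, mul_zero, phase_zero, mul_one]
    simp only
    rw [← mul_colMat, ← sand_sand, sand_colMat_gram (hdx d)]
  have hend (d : M.Dart) : (arc d).pos (arc d).angle = sand (C (TriSurface.right d)) 1 := by
    rw [hangle, (hform d).pos_eq, hT]
    simp only
    rw [← sand_colMat_phase, ← sand_colMat_gram (hdx d), sand_sand, mul_colMat, hCx, hCy]
    congr 2
    · congr 2
      ring
    · congr 2
      ring
  -- the horospheres
  obtain ⟨horo, hhoro⟩ : ∃ horo : M.Vertex → Mat, ∀ d, horo (TriSurface.src d) =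
      ((2 / sqLen (x d) : ℝ) : ℂ) • vecMulVec ((C (TriSurface.left d) : Mat) *ᵥ x d)
        (fun l => conj (((C (TriSurface.left d) : Mat) *ᵥ x d) l)) := by
    obtain ⟨W, hW⟩ : ∃ W : M.Dart → Mat, W = fun d => ((2 / sqLen (x d) : ℝ) : ℂ) •
        vecMulVec ((C (TriSurface.left d) : Mat) *ᵥ x d)
        (fun l => conj (((C (TriSurface.left d) : Mat) *ᵥ x d) l)) := ⟨_, rfl⟩
    have hinv (d : M.Dart) : W (M.rot d) = W d := by
      have e : x (M.rot d) = x d := by simp only [hx, TriSurface.src_rot]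
      simp only [hW]
      rw [TriSurface.left_rot, e, hCx, vecMulVec_phase_smul]
    refine ⟨fun v => W (Quotient.out v), fun d => ?_⟩
    have hout : TriSurface.src (Quotient.out (TriSurface.src d)) = TriSurface.src d :=
      Quotient.out_eq _
    show W (Quotient.out (TriSurface.src d)) = _
    rw [TriSurface.eq_of_src_eq hinv hout, hW]
  have hsrc (d : M.Dart) : horo (TriSurface.src d) = sand (T d) (herm (2 / sqLen (x d)) 0 0) := by
    rw [hhoro, hT, sand_colMat_left]
  have htgt (d : M.Dart) : horo (TriSurface.tgt d) = sand (T d) (herm 0 (2 / sqLen (y d)) 0) := by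
    have e : x (M.next d) = y d := by simp only [hx, hy, TriSurface.src_next]
    rw [← TriSurface.src_next, hhoro, TriSurface.left_next, e, hT, sand_colMat_right]
  have hDn (d : M.Dart) := (Complex.normSq_pos.2 (hdx d)).ne'
  have hri (d : M.Dart) : 2 / sqLen (x d) * Complex.normSq (T d).det * gramDiag (y d) (x d) = 2 := by
    have := (sqLen_pos (hx0 d)).ne'
    have := hDn d
    rw [hTd, gramDiag, normSq_det_colMat_swap (x d) (y d)]
    field_simp
  have hrj (d : M.Dart) : 2 / sqLen (y d) * Complex.normSq (T d).det * gramDiag (x d) (y d) = 2 := by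
    have := (sqLen_pos (hy0 d)).ne'
    have := hDn d
    rw [hTd, gramDiag]
    field_simp
  have hdet (d : M.Dart) : Complex.normSq (T d).det *
      (gramDiag (x d) (y d) * gramDiag (y d) (x d) - Complex.normSq (gramOff (x d) (y d))) = 1 := by
    rw [hTd]
    exact det_gram (hdx d)
  have hmem (d : M.Dart) (s : ℝ) : (arc d).pos s ∈
      horosphere (horo (TriSurface.src d)) ∩ horosphere (horo (TriSurface.tgt d)) := by
    have hhyp : (arc d).pos s ∈ hyperbolicSpace := by
      rw [hpos]
      exact mem_hyperbolicSpace_of_det (by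
        rw [Matrix.det_mul, det_rotor (hdx d), Matrix.SpecialLinearGroup.det_coe, one_mul])
    refine ⟨⟨hhyp, ?_⟩, ⟨hhyp, ?_⟩⟩
    · rw [hsrc, (hform d).mink_pos_left, hri]
      norm_num
    · rw [htgt, (hform d).mink_pos_right, hrj]
      norm_num
  obtain ⟨ρ, hρ⟩ : ∃ ρ : M.Dart → ℝ, ρ = fun d =>
    √(Complex.normSq (T d).det * Complex.normSq (gramOff (x d) (y d))) := ⟨_, rfl⟩
  have hρ0 (d : M.Dart) : 0 < ρ d := by rw [hρ]; exact Real.sqrt_pos.2 (hform d).normSq_pos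
  have hρ2 (d : M.Dart) : ρ d ^ 2 =
      Complex.normSq (T d).det * Complex.normSq (gramOff (x d) (y d)) := by
    rw [hρ]; exact Real.sq_sqrt (hform d).normSq_pos.le
  refine ⟨{ point := fun u => sand (C u) 1
            point_mem := fun u => mem_hyperbolicSpace_of_det (C u).det_coe
            gauss := z
            gauss_delaunay := hzD
            horo := horo
            horo_gauss := fun v => ?_
            point_mem_horo := fun d => by
              rw [← hstart]
              exact (hmem d 0).1
            arc := arc
            arc_mem := hmem
            arc_start := hstart
            arc_end := hend
            arc_opp_angle := fun d => by rw [hangle, hangle, hφo]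
            arc_opp := fun d s => ?_
            dihedral := fun d => 2 * Real.arctan (-(-η d) / ρ d)
            dihedral_mem := fun d => ?_
            cos_dihedral := fun d s _ => ?_
            sin_dihedral := fun d s _ => ?_ }, rfl, fun u => ?_, fun d => ?_⟩
  · obtain ⟨d, rfl⟩ := Quotient.exists_rep v
    change LightVector (horo (TriSurface.src d)) (z (TriSurface.src d))
    obtain ⟨c, hc, he⟩ := hz d
    refine ⟨2 / sqLen (x d) * Complex.normSq c,
      mul_pos (div_pos two_pos (sqLen_pos (hx0 d))) (Complex.normSq_pos.2 hc), ?_⟩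
    have hex : (C (TriSurface.left d) : Mat) *ᵥ x d = c • homog (z (TriSurface.src d)) := by
      rw [hx]; exact he
    rw [hhoro, hex, Complex.ofReal_mul, mul_smul]
    congr 1
    ext i j
    simp only [vecMulVec_apply, Pi.smul_apply, Matrix.smul_apply, smul_eq_mul, map_mul,
      ← Complex.mul_conj]
    ring
  -- The frame in the right triangle has its columns swapped and multiplied by phases; these phases
  -- shift the start of the reversed arc to the end of the original one.
  · rw [hangle, (hform d).pos_eq, (hform (M.opp d)).pos_eq, hT]
    simp only
    change sand (colMat ((C (TriSurface.right d) : Mat) *ᵥ x (M.opp d))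
      ((C (TriSurface.right d) : Mat) *ᵥ y (M.opp d))) _ = _
    rw [hxo, hyo, hηo, hCx, hCy, gramOff_swap]
    have e1 : conj (gramOff (x d) (y d)) * phase (-η d * s) =
        conj (gramOff (x d) (y d) * phase (η d * s)) := by
      rw [map_mul, conj_phase, neg_mul]
    have e2 : phase (η d * φ d / 2) = phase (-(-(η d * φ d) / 2)) := by congr 1; ring
    have e3 : phase (-(η d * φ d / 2)) = phase (-(η d * φ d) / 2) := by congr 1; ring
    rw [e1, e2, e3, sand_colMat_swap, sand_colMat_phase, mul_assoc, ← phase_add]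
    congr 4
    ring
  · have h1 := Real.neg_pi_div_two_lt_arctan (-(-η d) / ρ d)
    have h2 := Real.arctan_lt_pi_div_two (-(-η d) / ρ d)
    constructor <;> linarith
  · rw [cos_two_arctan_inv (hρ0 d) (hη' d), hsrc, htgt]
    exact ((hform d).mink_normal (hri d) (hrj d) (hdet d) s (hρ2 d)).symm
  · rw [sin_two_arctan_inv (hρ0 d) (hη' d), hsrc, htgt]
    exact ((hform d).triple_normal (hri d) (hrj d) (hdet d) s (hρ0 d) (hρ2 d)).symm
  · simp [sand]
  · have hs := Real.sqrt_sq (hρ0 d).le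
    rw [hρ2] at hs
    change (arc d).length * Real.tan (2 * Real.arctan (-(-η d) / ρ d) / 2) = _
    have := (hρ0 d).ne'
    rw [(hform d).length_eq, hangle, hs, mul_div_cancel_left₀ _ (two_ne_zero' ℝ), Real.tan_arctan]
    field_simp

/-! ### Countability of the set of darts. -/

namespace TriSurface

variable {M : TriSurface}

theorem exists_next_pow {d e : M.Dart} (h : left d = left e) : ∃ n : ℕ, (M.next ^ n) d = e := by
  obtain ⟨j, rfl⟩ : M.next.SameCycle d e := Quotient.exact h
  have hinv : M.next⁻¹ = M.next ^ 2 := by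
    rw [inv_eq_iff_mul_eq_one]
    ext x
    simp [pow_succ, M.next_next_next]
  obtain ⟨n, rfl | rfl⟩ := j.eq_nat_or_neg
  · exact ⟨n, by rw [zpow_natCast]⟩
  · exact ⟨2 * n, by rw [pow_mul, ← hinv, _root_.zpow_neg, zpow_natCast, inv_pow]⟩

/-- Apply a word in `next` and `opp` to a dart. -/
def word (l : List Bool) (d : M.Dart) : M.Dart :=
  l.foldl (fun d b => if b then M.next d else M.opp d) d

theorem word_append (l m : List Bool) (d : M.Dart) : word (l ++ m) d = word m (word l d) :=
  List.foldl_append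

theorem word_replicate (n : ℕ) (d : M.Dart) :
    word (List.replicate n true) d = (M.next ^ n) d := by
  induction n with
  | zero => rfl
  | succ n ih =>
    rw [List.replicate_succ', word_append, ih, pow_succ', Equiv.Perm.mul_apply]
    rfl

theorem IsDualPath.exists_word {d e : M.Dart} {p : List M.Dart}
    (h : IsDualPath (left d) p (left e)) : ∃ l, word l d = e := by
  induction p generalizing d with
  | nil =>
    obtain ⟨n, hn⟩ := exists_next_pow (show left d = left e from h)
    exact ⟨_, (word_replicate n d).trans hn⟩
  | cons c p ih =>
    obtain ⟨n, hn⟩ := exists_next_pow h.1.symm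
    obtain ⟨l, hl⟩ := ih (d := M.opp c) h.2
    refine ⟨List.replicate n true ++ [false] ++ l, ?_⟩
    rw [word_append, word_append, word_replicate, hn, ← hl]
    rfl

/-- By connectedness every dart is reached from a fixed one by a finite word in `next` and `opp`. -/
theorem countable_dart (hM : M.SimplyConnected) : Countable M.Dart := by
  rcases isEmpty_or_nonempty M.Dart with hE | ⟨⟨d⟩⟩
  · infer_instance
  · refine Function.Surjective.countable (f := fun l => word l d) fun e => ?_
    obtain ⟨p, hp⟩ := hM.1 (left d) (left e)
    exact hp.exists_word

end TriSurface

/-! ### Translations that avoid antipodal edges. -/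

/-- The translation `z ↦ z + t`. -/
def translation (t : ℝ) : SL2 := ⟨!![1, (t : ℂ); 0, 1], by simp [Matrix.det_fin_two]⟩

theorem hermProd_translation (t : ℝ) (x y : Fin 2 → ℂ) :
    hermProd ((translation t : Mat) *ᵥ x) ((translation t : Mat) *ᵥ y) =
      x 1 * conj (y 1) * (t : ℂ) ^ 2 + (x 0 * conj (y 1) + x 1 * conj (y 0)) * t +
        (x 0 * conj (y 0) + x 1 * conj (y 1)) := by
  simp [translation, hermProd, dotProduct, Fin.sum_univ_two, Matrix.mulVec]
  ring

theorem finite_hermProd_translation (z w : OnePoint ℂ) :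
    {t : ℝ | hermProd ((translation t : Mat) *ᵥ homog z)
      ((translation t : Mat) *ᵥ homog w) = 0}.Finite := by
  set x := homog z with hx
  set y := homog w with hy
  set P : Polynomial ℂ := Polynomial.C (x 1 * conj (y 1)) * Polynomial.X ^ 2 +
    Polynomial.C (x 0 * conj (y 1) + x 1 * conj (y 0)) * Polynomial.X +
    Polynomial.C (x 0 * conj (y 0) + x 1 * conj (y 1)) with hP
  -- One coefficient is 1: the quadratic one if both points are finite, the linear one if exactly
  -- one is infinite, the constant one if both are.
  have hP0 : P ≠ 0 := by
    intro h
    have c0 := congrArg (fun Q => Polynomial.coeff Q 0) h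
    have c1 := congrArg (fun Q => Polynomial.coeff Q 1) h
    have c2 := congrArg (fun Q => Polynomial.coeff Q 2) h
    simp [hP, Polynomial.coeff_X, Polynomial.coeff_C] at c0 c1 c2
    induction z using OnePoint.rec <;> induction w using OnePoint.rec <;>
      simp [hx, hy, homog] at c0 c1 c2
  refine ((Polynomial.finite_setOfPred_isRoot hP0).preimage
    Complex.ofReal_injective.injOn).subset fun t ht => ?_
  rw [Set.mem_ofPred_eq, hermProd_translation] at ht
  simpa [hP, Polynomial.IsRoot] using ht

theorem exists_translation {ι : Type*} [Countable ι] (z w : ι → OnePoint ℂ) :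
    ∃ t : ℝ, ∀ i, hermProd ((translation t : Mat) *ᵥ homog (z i))
      ((translation t : Mat) *ᵥ homog (w i)) ≠ 0 := by
  have hc := Set.countable_iUnion fun i => (finite_hermProd_translation (z i) (w i)).countable
  by_contra! h
  refine Cardinal.not_countable_real (hc.mono fun t _ => ?_)
  obtain ⟨i, hi⟩ := h t
  exact Set.mem_iUnion.2 ⟨i, hi⟩

end DiscreteCMC

end

/-! ### The duality theorem. -/

open DiscreteCMC in
theorem corollary4p4 (M : DiscreteCMC.TriSurface) (hM : M.SimplyConnected)
    (f : DiscreteCMC.HorosphericalNet M) (hf : f.IsCMC1) :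
    ∃ (z : M.Vertex → OnePoint ℂ) (A : M.Face → DiscreteCMC.SL2),
      DiscreteCMC.IsDelaunay z ∧
      DiscreteCMC.IsOsculating z f.gauss A ∧
      (∀ u, f.point u = (A u : DiscreteCMC.Mat) * (A u : DiscreteCMC.Mat)ᴴ) ∧
      ((∀ d : M.Dart, ¬ DiscreteCMC.Antipodal
          (f.gauss (DiscreteCMC.TriSurface.src d)) (f.gauss (DiscreteCMC.TriSurface.tgt d))) →
        ∃ g : DiscreteCMC.HorosphericalNet M, g.IsCMC1 ∧ g.gauss = z ∧
          (∀ u, g.point u =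
            (((A u)⁻¹ : DiscreteCMC.SL2) : DiscreteCMC.Mat) *
              (((A u)⁻¹ : DiscreteCMC.SL2) : DiscreteCMC.Mat)ᴴ) ∧
          ∀ d : M.Dart, g.length d * Real.tan (g.dihedral d / 2) =
            -(f.length d * Real.tan (f.dihedral d / 2))) ∧
      ∃ (B : DiscreteCMC.SL2) (g : DiscreteCMC.HorosphericalNet M), g.IsCMC1 ∧ g.gauss = z ∧
        (∀ u, g.point u =
          (((B * A u)⁻¹ : DiscreteCMC.SL2) : DiscreteCMC.Mat) *
            (((B * A u)⁻¹ : DiscreteCMC.SL2) : DiscreteCMC.Mat)ᴴ) ∧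
        ∀ d : M.Dart, g.length d * Real.tan (g.dihedral d / 2) =
          -(f.length d * Real.tan (f.dihedral d / 2)) := by
  obtain ⟨η, R, hη, hηo, hterm, hR, -, hRo, hpoint⟩ := f.exists_rotation
  obtain ⟨θ, hθ⟩ : ∃ θ : M.Dart → ℝ, ∀ d, θ d = η d * (f.arc d).angle := ⟨_, fun _ => rfl⟩
  simp only [← hθ] at hterm hR
  have hθo (d : M.Dart) : θ (M.opp d) = θ d := by rw [hθ, hθ, hηo, f.arc_opp_angle]
  -- The areas cancel in the mean curvature equation, leaving a zero sum of edge terms.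
  have hsum (v : M.Vertex) : ∑ d ∈ TriSurface.star v, θ d = 0 := by
    have h := hf.mean_curvature v
    simp only [HorosphericalNet.meanCurvature, hterm, Finset.sum_neg_distrib] at h
    linarith
  obtain ⟨A, hA, hfA⟩ := exists_transport hM hRo
    (hol_vertexLoop (fun v => homog_ne_zero (f.gauss v)) hR f.point_mem hpoint hsum)
    f.point_mem hpoint
  have hC (d : M.Dart) : (((A (TriSurface.right d))⁻¹ : SL2) : Mat) *ᵥ
      homog (f.gauss (TriSurface.src d)) = phase (-(θ d / 2)) •
        (((A (TriSurface.left d))⁻¹ : SL2) : Mat) *ᵥ homog (f.gauss (TriSurface.src d)) := by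
    have e : (A (TriSurface.right d) : Mat) *ᵥ (phase (-(θ d / 2)) •
        (((A (TriSurface.left d))⁻¹ : SL2) : Mat) *ᵥ homog (f.gauss (TriSurface.src d))) =
        homog (f.gauss (TriSurface.src d)) := by
      rw [hA, Matrix.SpecialLinearGroup.coe_mul, Matrix.mulVec_smul, ← Matrix.mulVec_mulVec,
        coe_mulVec_coe_inv_mulVec, hR, smul_smul, mul_comm, phase_mul_neg, one_smul]
    conv_lhs => rw [← e]
    rw [coe_inv_mulVec_coe_mulVec]
  obtain ⟨z, hz⟩ := exists_pattern (h := fun v => homog (f.gauss v)) (C := fun u => (A u)⁻¹) hC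
    fun v => homog_ne_zero _
  have h0 (d : M.Dart) : 0 ≤ -θ d + (crossRatio f.gauss d).arg := hterm d ▸ hf.edge_nonneg d
  have hπ (d : M.Dart) : -θ d + (crossRatio f.gauss d).arg < Real.pi := hterm d ▸ hf.edge_lt d
  have hzD : IsDelaunay z := isDelaunay_of_transition (C := fun u => (A u)⁻¹) hC (fun _ => rfl) hz
    hθo f.gauss_delaunay h0 hπ hsum
  have harg := arg_crossRatio_eq (C := fun u => (A u)⁻¹) hC (fun _ => rfl) hz hθo
    f.gauss_delaunay h0 hπ
  -- Both parts are instances of this, with B = 1 and B a translation. Since (BA)⁻¹B = A⁻¹,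
  -- replacing the vectors h by Bh leaves z and the phases unchanged and affects only Hermitian
  -- products.
  have dual (B : SL2) (hB : ∀ d : M.Dart,
      hermProd ((B : Mat) *ᵥ homog (f.gauss (TriSurface.src d)))
        ((B : Mat) *ᵥ homog (f.gauss (TriSurface.tgt d))) ≠ 0) :
      ∃ g : HorosphericalNet M, g.IsCMC1 ∧ g.gauss = z ∧
        (∀ u, g.point u = (((B * A u)⁻¹ : SL2) : Mat) * (((B * A u)⁻¹ : SL2) : Mat)ᴴ) ∧
        ∀ d : M.Dart, g.length d * Real.tan (g.dihedral d / 2) =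
          -(f.length d * Real.tan (f.dihedral d / 2)) := by
    have hCB (u : M.Face) (x : Fin 2 → ℂ) : (((B * A u)⁻¹ : SL2) : Mat) *ᵥ ((B : Mat) *ᵥ x) =
        (((A u)⁻¹ : SL2) : Mat) *ᵥ x := by
      rw [mul_inv_rev, Matrix.SpecialLinearGroup.coe_mul, ← Matrix.mulVec_mulVec,
        coe_inv_mulVec_coe_mulVec]
    obtain ⟨g, rfl, hgp, hgt⟩ := exists_net (C := fun u => (B * A u)⁻¹)
      (k := fun v => (B : Mat) *ᵥ homog (f.gauss v)) (φ := fun d => (f.arc d).angle) hzD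
      (fun v => coe_mulVec_ne_zero B (homog_ne_zero _)) hη hηo (fun d => (f.arc d).angle_nonneg)
      (fun d => (f.arc d).angle_le) f.arc_opp_angle
      (fun d => by rw [hCB, hCB, hC, hθ]) (fun d => by simpa only [hCB] using hz d)
      (fun d => by rw [det_mul_colMat]; exact f.det_frame_ne_zero d) hB
    simp only [← hθ] at hgt
    refine ⟨g, ⟨fun v => ?_, fun d => ?_, fun d => ?_⟩, rfl, hgp, fun d => ?_⟩
    · simp only [HorosphericalNet.meanCurvature, hgt, hsum]
      ring
    -- The new edge term θ cancels the shift -θ of the argument, so the bounds are those of the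
    -- original Delaunay pattern.
    · rw [hgt, harg]
      linarith [f.gauss_delaunay.arg_nonneg d]
    · rw [hgt, harg]
      linarith [f.gauss_delaunay.arg_lt d]
    · have h1 := hgt d
      have h2 := hterm d
      rw [HorosphericalNet.edgeTerm] at h1 h2
      rw [h1, h2, neg_neg]
  refine ⟨z, A, hzD, fun d => ?_, hfA, fun hnon => ?_, ?_⟩
  · obtain ⟨c, hc, he⟩ := hz d
    refine ⟨c⁻¹, inv_ne_zero hc, ?_⟩
    rw [eq_inv_smul_iff₀ hc, ← Matrix.mulVec_smul, ← he, coe_mulVec_coe_inv_mulVec]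
  · have := dual 1 fun d => by
      rw [Matrix.SpecialLinearGroup.coe_one, Matrix.one_mulVec, Matrix.one_mulVec]
      exact hnon d
    simpa only [one_mul] using this
  · have := TriSurface.countable_dart hM
    obtain ⟨t, ht⟩ := exists_translation (fun d : M.Dart => f.gauss (TriSurface.src d))
      fun d => f.gauss (TriSurface.tgt d)
    exact ⟨translation t, dual _ ht⟩
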